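/- Let $\mathcal H$ be a complex Hilbert space and $V\subseteq\mathcal H$ a standard subspace, i.e. a closed real subspace with $V\cap iV=\{0\}$ and $V+iV$ dense in $\mathcal H$. Let $\sigma_V\colon V+iV\to\mathcal H$, $x+iy\mapsto x-iy$, put $\Delta_V=\sigma_V^*\sigma_V$, and let $J_V$ be the conjugation in the polar decomposition $\sigma_V=J_V\Delta_V^{1/2}$. Let $\mathcal A_V=\{A\in B(\mathcal H): AV\subseteq V\}$ and $A^\sharp=J_VA^*J_V$ for $A\in B(\mathcal H)$. For $A\in\mathcal A_V$, let $z\mapsto\alpha^A(z)\in B(\mathcal H)$ denote the unique strongly continuous extension of $\alpha^A(t)=\Delta_V^{-it/2\pi}A\,\Delta_V^{it/2\pi}$ ($t\in\mathbb R$) to the closed strip $\{z\in\mathbb C: 0\le\operatorname{Im}z\le\pi\}$ that is holomorphic on the open strip. Then $\sharp$ is an isometric involution of the real Banach algebra $B(\mathcal H)$, $\mathcal A_V$ is a closed $\sharp$-invariant real subalgebra containing $\mathbf 1$, the extension $\alpha^A$ exists and is unique for every $A\in\mathcal A_V$, and for every $z$ with $0\le\operatorname{Im}z\le\pi$ the map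 $$\alpha_z\colon(\mathcal A_V,\sharp)\to(B(\mathcal H),\sharp),\qquad A\mapsto\alpha^A(z),$$ is an injective contractive morphism of real involutive unital Banach algebras: it is real-linear, multiplicative and unital, $\alpha_z(A^\sharp)=\alpha_z(A)^\sharp$, and $\|\alpha_z(A)\|\le\|A\|$. Moreover: (i) The restriction of $\alpha_z$ to the closed unit ball $\{A\in\mathcal A_V:\|A\|\le1\}$ is continuous with respect to the strong operator topology on the ball and on $B(\mathcal H)$. (ii) For $z=\pi i/2$ and $A\in\mathcal A_V$ we have $\alpha_{\pi i/2}(A)^*=\alpha_{\pi i/2}(A^\sharp)$ and $\alpha_{\pi i/2}(A)J_V=J_V\alpha_{\pi i/2}(A)$, so that $\alpha_{\pi i/2}$ defines, by restriction, a $*$-representation of $(\mathcal A_V,\sharp)$ on the real Hilbert space $\mathcal H^{J_V}=\{\xi\in\mathcal H:J_V\xi=\xi\}$. -/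

import Mathlib

open Complex
open scoped ComplexInnerProductSpace ClosedSubmodule

noncomputable section

namespace StdSub

variable {H : Type*} [NormedAddCommGroup H] [InnerProductSpace ℂ H]

/-! ### The Tomita operator of a standard subspace -/

/-- The graph `{(x + i y, x - i y) : x, y ∈ V}` of the Tomita operator `σ_V`. -/
def tomitaGraph (V : StandardSubspace H) : Submodule ℝ (H × H) where
  carrier := {p | ∃ x ∈ V.toClosedSubmodule, ∃ y ∈ V.toClosedSubmodule,
    p.1 = x + I • y ∧ p.2 = x - I • y}
  zero_mem' := ⟨0, zero_mem _, 0, zero_mem _, by simp, by simp⟩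
  add_mem' := by
    rintro p q ⟨x, hx, y, hy, h1, h2⟩ ⟨x', hx', y', hy', h1', h2'⟩
    refine ⟨x + x', add_mem hx hx', y + y', add_mem hy hy', ?_, ?_⟩
    · rw [Prod.fst_add, h1, h1', smul_add]; abel
    · rw [Prod.snd_add, h2, h2', smul_add]; abel
  smul_mem' := by
    rintro c p ⟨x, hx, y, hy, h1, h2⟩
    refine ⟨c • x, SMulMemClass.smul_mem c hx, c • y, SMulMemClass.smul_mem c hy, ?_, ?_⟩
    · rw [Prod.smul_fst, h1, smul_add, smul_comm c I y]
    · rw [Prod.smul_snd, h2, smul_sub, smul_comm c I y]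

/-- The Tomita operator `σ_V : V + i V → H`, `x + i y ↦ x - i y`. It is antilinear; as a partially
defined map it is regarded as a real-linear one. -/
def tomita (V : StandardSubspace H) : H →ₗ.[ℝ] H := (tomitaGraph V).toLinearPMap

lemma tomitaGraph_smul (V : StandardSubspace H) (c : ℂ) {a b : H} (h : (a, b) ∈ tomitaGraph V) :
    (c • a, star c • b) ∈ tomitaGraph V := by
  obtain ⟨x, hx, y, hy, h1, h2⟩ := h
  simp only at h1 h2
  refine ⟨c.re • x + (-c.im) • y,
    add_mem (SMulMemClass.smul_mem _ hx) (SMulMemClass.smul_mem _ hy),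
    c.re • y + c.im • x, add_mem (SMulMemClass.smul_mem _ hy) (SMulMemClass.smul_mem _ hx), ?_, ?_⟩
  · simp only [h1, ← Complex.coe_smul]
    match_scalars <;> apply Complex.ext <;> simp
  · simp only [h2, ← Complex.coe_smul]
    match_scalars <;> apply Complex.ext <;> simp

lemma tomita_graph (V : StandardSubspace H) : (tomita V).graph = tomitaGraph V := by
  apply Submodule.toLinearPMap_graph_eq
  rintro ⟨a, b⟩ ⟨x, hx, y, hy, h1, h2⟩ h0
  simp only at h1 h2 h0
  have hxy : x = -(I • y) := eq_neg_of_add_eq_zero_left (h1.symm.trans h0)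
  have hmem : x ∈ V.toClosedSubmodule ⊓ V.toClosedSubmodule.mulI := by
    refine ⟨hx, ?_⟩
    refine (ClosedSubmodule.mem_mapEquiv_iff (scalarSMulCLE H UnitI) _ _).2 ?_
    have : (scalarSMulCLE H UnitI).symm x = -y := by
      rw [scalarSMulCLE_symm_apply, Units.smul_def, Units.val_inv_eq_inv_val, Complex.val_UnitI, inv_I, hxy,
        smul_neg, neg_smul, neg_neg, smul_smul, I_mul_I, neg_one_smul]
    rw [this]
    simpa using SMulMemClass.smul_mem (-1 : ℝ) hy
  rw [V.IsSeparating] at hmem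
  have hx0 : x = 0 := by simpa using hmem
  have : I • y = 0 := by rw [hx0] at hxy; exact neg_eq_zero.1 hxy.symm
  simp only [h2, hx0, this, sub_zero]

/-! ### The modular operator -/

/-- The graph of `σ_V* σ_V`: the pairs `(x, z)` with `x` in the domain of `σ_V`, `y = σ_V x` in the
domain of the antilinear adjoint `σ_V*`, and `z = σ_V* y`, that is
`⟪a, z⟫ = ⟪y, σ_V a⟫` for all `a` in the domain of `σ_V`. -/
def modularGraph (V : StandardSubspace H) : Submodule ℂ (H × H) where
  carrier := {p | ∃ y, (p.1, y) ∈ (tomita V).graph ∧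
    ∀ a b, (a, b) ∈ (tomita V).graph → ⟪a, p.2⟫ = ⟪y, b⟫}
  zero_mem' := ⟨0, (tomita V).graph.zero_mem, by simp⟩
  add_mem' := by
    rintro p q ⟨y, hy, h⟩ ⟨y', hy', h'⟩
    refine ⟨y + y', by simpa using! add_mem hy hy', fun a b hab => ?_⟩
    rw [Prod.snd_add, inner_add_right, inner_add_left, h a b hab, h' a b hab]
  smul_mem' := by
    rintro c p ⟨y, hy, h⟩
    rw [tomita_graph] at hy h
    simp only [Set.mem_ofPred_eq, tomita_graph]
    refine ⟨star c • y, tomitaGraph_smul V c hy, fun a b hab => ?_⟩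
    rw [Prod.smul_snd, inner_smul_right, inner_smul_left, h a b hab]
    simp

/-- The modular operator `Δ_V = σ_V* σ_V`. -/
def modularOperator (V : StandardSubspace H) : H →ₗ.[ℂ] H := (modularGraph V).toLinearPMap

/-! ### Complex powers of a positive injective selfadjoint operator -/

open scoped Classical in
/-- The bounded operator that agrees with the partially defined operator `T`, if `T` is everywhere
defined and bounded. -/
def toBounded (T : H →ₗ.[ℂ] H) : H →L[ℂ] H :=
  if h : ∃ W : H →L[ℂ] H, ∀ ξ, (ξ, W ξ) ∈ T.graph then h.choose else 0

open scoped Classical in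
/-- The resolvent `(1 + T)⁻¹` as a bounded operator on `H`, if `1 + T` has a bounded everywhere
defined inverse (as is the case for a positive selfadjoint `T`): `η = (1 + T)⁻¹ ξ` means that `η` is
in the domain of `T` and `η + T η = ξ`. -/
def invOneAdd (T : H →ₗ.[ℂ] H) : H →L[ℂ] H :=
  if h : ∃ C : H →L[ℂ] H, ∀ ξ η, C ξ = η ↔ (η, ξ - η) ∈ T.graph then h.choose else 0

variable [CompleteSpace H]

/-- For positive selfadjoint injective `T` and `|Re w| < 1`, the graph of the power `T ^ w` in the
(regularized) functional calculus. With `C = (1 + T)⁻¹` one has `T = (1 - C) C⁻¹`, that is, spectral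
values correspond by `c = 1 / (1 + t)`, `t = (1 - c) / c`. The operator `C (1 - C)` is injective,
`c (1 - c) ((1 - c) / c) ^ w` is a continuous function on `[0, 1]` (with value `0` at `0` and `1`),
and `T ^ w = (C (1 - C))⁻¹ [c (1 - c) ((1 - c) / c) ^ w](C)` with its natural domain. -/
def cpowGraph (T : H →ₗ.[ℂ] H) (w : ℂ) : Submodule ℂ (H × H) where
  carrier := {p | (invOneAdd T * (1 - invOneAdd T)) p.2 =
    cfc (fun c : ℂ => ((c.re * (1 - c.re) : ℝ) : ℂ) * (((1 - c.re) / c.re : ℝ) : ℂ) ^ w)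
      (invOneAdd T) p.1}
  zero_mem' := by simp
  add_mem' := by
    intro p q hp hq
    simp only [Set.mem_ofPred_eq, Prod.fst_add, Prod.snd_add, map_add] at hp hq ⊢
    rw [hp, hq]
  smul_mem' := by
    intro c p hp
    simp only [Set.mem_ofPred_eq, Prod.smul_fst, Prod.smul_snd, map_smul] at hp ⊢
    rw [hp]

/-- The power `T ^ w` of a positive selfadjoint injective operator `T`, for `|Re w| < 1`. -/
def cpow (T : H →ₗ.[ℂ] H) (w : ℂ) : H →ₗ.[ℂ] H := (cpowGraph T w).toLinearPMap

/-- The unitary operator `Δ_V ^ (i s)` of the modular group. -/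
def modularUnitary (V : StandardSubspace H) (s : ℝ) : H →L[ℂ] H :=
  toBounded (cpow (modularOperator V) (I * s))

/-! ### The modular conjugation -/

open scoped Classical in
/-- The modular conjugation `J_V`, the antilinear bounded operator in the polar decomposition
`σ_V = J_V Δ_V ^ (1/2)` (an identity of partially defined operators, including the domains). -/
def modularConj (V : StandardSubspace H) : H →L⋆[ℂ] H :=
  if h : ∃ J : H →L⋆[ℂ] H, ∀ ξ η, (ξ, η) ∈ (tomita V).graph ↔
    ∃ ζ, (ξ, ζ) ∈ (cpow (modularOperator V) (1 / 2)).graph ∧ J ζ = η then h.choose else 0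

/-- The real subspace `H^{J_V}` of the fixed points of `J_V`. -/
def fixedSubspace (V : StandardSubspace H) : Submodule ℝ H where
  carrier := {ξ | modularConj V ξ = ξ}
  zero_mem' := by simp
  add_mem' := by
    intro ξ η hξ hη
    simp only [Set.mem_ofPred_eq, map_add] at hξ hη ⊢
    rw [hξ, hη]
  smul_mem' := by
    intro c ξ hξ
    simp only [Set.mem_ofPred_eq] at hξ ⊢
    rw [← Complex.coe_smul, map_smulₛₗ, hξ, Complex.conj_ofReal]

instance (V : StandardSubspace H) : CompleteSpace (fixedSubspace V) :=
  (isClosed_eq (modularConj V).continuous continuous_id).completeSpace_coe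

/-! ### The algebra of `V`-real operators -/

/-- The real algebra `𝒜_V = {A ∈ B(H) : A V ⊆ V}`. -/
def realOperators (V : StandardSubspace H) : Subalgebra ℝ (H →L[ℂ] H) where
  carrier := {A | ∀ v ∈ V.toClosedSubmodule, A v ∈ V.toClosedSubmodule}
  mul_mem' := fun hA hB v hv => hA _ (hB v hv)
  add_mem' := fun hA hB v hv => add_mem (hA v hv) (hB v hv)
  algebraMap_mem' := fun r v hv => by
    have : (algebraMap ℝ (H →L[ℂ] H) r) v = r • v := by
      rw [Algebra.algebraMap_eq_smul_one]; rfl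
    rw [this]
    exact SMulMemClass.smul_mem r hv

/-- `A^♯ = J_V A* J_V`. -/
def sharp (V : StandardSubspace H) (A : H →L[ℂ] H) : H →L[ℂ] H :=
  (modularConj V).comp ((ContinuousLinearMap.adjoint A).comp (modularConj V))

/-- `s` is an isometric involution of a real normed algebra: additive, real-homogeneous,
antimultiplicative, involutive and isometric. -/
structure IsAlgInvolution {B : Type*} [NormedRing B] [NormedAlgebra ℝ B] (s : B → B) : Prop where
  map_add : ∀ a b, s (a + b) = s a + s b
  map_smul : ∀ (r : ℝ) a, s (r • a) = r • s a
  map_mul : ∀ a b, s (a * b) = s b * s a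
  map_map : ∀ a, s (s a) = a
  norm_map : ∀ a, ‖s a‖ = ‖a‖

/-! ### Analytic continuation of the orbit maps -/

/-- The open strip `{z : 0 < Im z < π}`. -/
def openStrip : Set ℂ := {z | 0 < z.im ∧ z.im < Real.pi}

/-- The closed strip `{z : 0 ≤ Im z ≤ π}`. -/
def closedStrip : Set ℂ := {z | 0 ≤ z.im ∧ z.im ≤ Real.pi}

/-- `F` is, on the closed strip, an extension of the orbit map
`t ↦ Δ_V ^ (-it/2π) A Δ_V ^ (it/2π)` that is strongly continuous there and holomorphic in the open
strip. -/
structure IsContinuation (V : StandardSubspace H) (A : H →L[ℂ] H) (F : ℂ → H →L[ℂ] H) : Prop where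
  real : ∀ t : ℝ, F t =
    modularUnitary V (-t / (2 * Real.pi)) * A * modularUnitary V (t / (2 * Real.pi))
  continuousOn : ∀ ξ : H, ContinuousOn (fun z => F z ξ) closedStrip
  differentiableOn : DifferentiableOn ℂ F openStrip

open scoped Classical in
/-- The extended orbit map `z ↦ α^A(z)` on the closed strip. -/
def orbit (V : StandardSubspace H) (A : H →L[ℂ] H) : ℂ → H →L[ℂ] H :=
  if h : ∃ F, IsContinuation V A F then h.choose else 0

/-- `B(H)` with the strong operator topology. -/
abbrev toSOT : (H →L[ℂ] H) ≃ₗ[ℂ] (H →Lₚₜ[ℂ] H) :=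
  ContinuousLinearMap.toUniformConvergenceCLM (RingHom.id ℂ) H {s : Set H | Finite s}

end StdSub

end

noncomputable section

namespace StdSub

open Filter Topology Set Metric

/-! ### Complex analysis -/

/-! Write Δ, σ, J for the modular objects of V. If A preserves V, it commutes with σ = JΔ^{1/2}, so
Δ^{1/2} A = (JAJ) Δ^{1/2} on the domain V + iV. Hence Δ^w A Δ^{-w} is a unitary orbit of A on the
line Re w = 0 and a unitary orbit of JAJ on the line Re w = 1/2. Both edges are bounded by ‖A‖, so
the three lines theorem bounds the strip between them, and w = -iz/2π turns it into 0 ≤ Im z ≤ π.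

Domains are avoided by multiplying with R_0 = C(1 - C), where C = (1 + Δ)⁻¹. It is injective with
dense range, and R_w = R_0 Δ^w (`regPow C w`) is bounded and holomorphic for |Re w| < 1. Operators
are compared after sandwiching them between two copies of R_0 (`regPow_zero_mul_mul_injective`). C
is `halfSum V`, half the sum of the real projections onto V and iV. With D = `halfDiff V`, half
their difference, one has D² = C(1 - C) and DC = (1 - C)D; the polar decomposition of D yields J.

The continuation rests on `regOrbit_half_add` (the upper edge), `norm_inner_regOrbit_le` (three
lines) and `exists_mul_mul_eq` (dividing by R_0 on both sides). The estimate ‖Δ^w a‖ ≤ max(‖a‖,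
‖Δ^{1/2} a‖) of `norm_le_of_regPow_eq` gives strong continuity both in z and in A. Multiplicativity
follows from uniqueness, and compatibility with ♯ from JΔ^wJ = Δ^{-w̄}. At the midpoint w = 1/4, the
same relation and Δ^{1/2} A Δ^{-1/2} = JAJ show that α(A) commutes with J. -/

lemma norm_slope_sub_slope_le {f : ℂ → ℂ} {c z z' : ℂ} {R M : ℝ}
    (hf : DifferentiableOn ℂ f (ball c R)) (hb : ∀ z ∈ ball c R, ‖f z‖ ≤ M)
    (hz : z ∈ ball c R) (hz' : z' ∈ ball c R) (hzc : z ≠ c) (hzc' : z' ≠ c) :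
    ‖slope f c z - slope f c z'‖ ≤ 4 * M / R ^ 2 * (dist z c + dist z' c) := by
  have hR : 0 < R := dist_nonneg.trans_lt (mem_ball.1 hz)
  have hc : c ∈ ball c R := mem_ball_self hR
  have h1 : ∀ z ∈ ball c R, ‖dslope f c z‖ ≤ 2 * M / R := by
    intro z hz
    refine norm_dslope_le_div_of_mapsTo_ball hf ?_ hz
    intro u hu
    rw [mem_closedBall, dist_eq_norm]
    linarith [norm_sub_le (f u) (f c), hb u hu, hb c hc]
  have hd : DifferentiableOn ℂ (dslope f c) (ball c R) :=
    (differentiableOn_dslope (isOpen_ball.mem_nhds hc)).2 hf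
  -- The Schwarz lemma a second time, now for the difference quotient, which `h1` bounds by 2M/R.
  have h2 : ∀ z ∈ ball c R, dist (dslope f c z) (dslope f c c) ≤ 4 * M / R ^ 2 * dist z c := by
    intro z hz
    have := dist_le_div_mul_dist_of_mapsTo_ball (R₂ := 4 * M / R) hd (fun u hu => by
      rw [mem_closedBall, dist_eq_norm]
      have h3 : 4 * M / R = 2 * M / R + 2 * M / R := by ring
      linarith [norm_sub_le (dslope f c u) (dslope f c c), h1 u hu, h1 c hc]) hz
    refine this.trans_eq ?_
    field_simp
  rw [← dslope_of_ne f hzc, ← dslope_of_ne f hzc', ← dist_eq_norm]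
  linarith [dist_triangle_right (dslope f c z) (dslope f c z') (dslope f c c), h2 z hz, h2 z' hz']

/-- The Cauchy criterion for difference quotients. Since the oscillation bound of
`norm_slope_sub_slope_le` depends on f only through its sup norm, it can be taken uniformly over
scalar functions or matrix coefficients, and then yields holomorphy in operator norm. -/
lemma differentiableAt_of_norm_slope_sub_slope_le {E : Type*} [NormedAddCommGroup E]
    [NormedSpace ℂ E] [CompleteSpace E] {F : ℂ → E} {c : ℂ} {R K : ℝ} (hR : 0 < R)
    (h : ∀ z ∈ ball c R, ∀ z' ∈ ball c R, z ≠ c → z' ≠ c →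
      ‖slope F c z - slope F c z'‖ ≤ K * (dist z c + dist z' c)) :
    DifferentiableAt ℂ F c := by
  have hcau : Cauchy (map (slope F c) (𝓝[≠] c)) := by
    refine Metric.cauchy_iff.2 ⟨inferInstance, fun ε hε => ?_⟩
    set r : ℝ := min R (ε / (2 * (|K| + 1))) with hr
    have hr0 : 0 < r := lt_min hR (by positivity)
    refine ⟨slope F c '' (ball c r ∩ {c}ᶜ), image_mem_map ?_, ?_⟩
    · exact inter_mem (mem_nhdsWithin_of_mem_nhds (ball_mem_nhds c hr0)) self_mem_nhdsWithin
    · rintro _ ⟨x, ⟨hx, hxc⟩, rfl⟩ _ ⟨y, ⟨hy, hyc⟩, rfl⟩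
      have hrR : ball c r ⊆ ball c R := ball_subset_ball (min_le_left _ _)
      rw [dist_eq_norm]
      refine (h x (hrR hx) y (hrR hy) hxc hyc).trans_lt ?_
      have h1 : dist x c + dist y c < 2 * r := by
        linarith [mem_ball.1 hx, mem_ball.1 hy]
      have h2 : 0 ≤ dist x c + dist y c := by positivity
      have h3 : r * (2 * (|K| + 1)) ≤ ε := by
        rw [← le_div_iff₀ (by positivity)]; exact min_le_right _ _
      nlinarith [le_abs_self K, abs_nonneg K]
  obtain ⟨l, hl⟩ := CompleteSpace.complete hcau
  exact (hasDerivAt_iff_tendsto_slope.2 hl).differentiableAt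

/-- A function on the closed strip that is bounded, holomorphic inside and bounded by `C` on the
boundary is bounded by `C`. -/
lemma norm_le_of_vertical_strip {f : ℂ → ℂ} {a b C M : ℝ} (hab : a < b)
    (hf : DiffContOnCl ℂ f (re ⁻¹' Ioo a b)) (hM : ∀ z, z.re ∈ Ioo a b → ‖f z‖ ≤ M)
    (ha : ∀ z : ℂ, z.re = a → ‖f z‖ ≤ C) (hb : ∀ z : ℂ, z.re = b → ‖f z‖ ≤ C) {z : ℂ}
    (hz : z.re ∈ Icc a b) : ‖f z‖ ≤ C := by
  refine PhragmenLindelof.vertical_strip hf ⟨0, ?_, 0, ?_⟩ ha hb hz.1 hz.2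
  · exact div_pos Real.pi_pos (sub_pos.2 hab)
  · refine Asymptotics.IsBigO.of_bound M ?_
    refine eventually_inf_principal.2 (Eventually.of_forall fun z hz => ?_)
    simpa using hM z hz

lemma isOpen_openStrip : IsOpen openStrip :=
  (isOpen_lt continuous_const continuous_im).inter (isOpen_lt continuous_im continuous_const)

lemma openStrip_subset_closedStrip : openStrip ⊆ closedStrip := fun _ hz => ⟨hz.1.le, hz.2.le⟩

lemma closedStrip_subset_closure : closedStrip ⊆ closure openStrip := by
  intro z hz
  have : closure (im ⁻¹' Ioo 0 Real.pi) = im ⁻¹' Icc 0 Real.pi := by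
    rw [closure_preimage_im, closure_Ioo Real.pi_pos.ne]
  have hz' : z ∈ im ⁻¹' Icc 0 Real.pi := hz
  rw [← this] at hz'
  exact hz'

lemma convex_openStrip : Convex ℝ openStrip := by
  have : openStrip = Complex.imLm ⁻¹' Ioo 0 Real.pi := rfl
  rw [this]
  exact (convex_Ioo _ _).linear_preimage _

/-- Take the product of f(c + kz) over k = ±1, ±i on the square of half side Im c around 0. On each
side of the square one of the four arguments is real, so the product vanishes on the boundary, and
the maximum principle gives f(c)⁴ = 0. The bound 2 Im c < π keeps all four arguments in the closed
strip. -/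
lemma eq_zero_of_square {f : ℂ → ℂ} (hc : ContinuousOn f closedStrip)
    (hd : DifferentiableOn ℂ f openStrip) (h0 : ∀ t : ℝ, f t = 0) {c : ℂ}
    (hc0 : 0 < c.im) (hcπ : 2 * c.im < Real.pi) : f c = 0 := by
  set y := c.im with hy
  set U : Set ℂ := Ioo (-y) y ×ℂ Ioo (-y) y with hU
  have hcl : closure U = Icc (-y) y ×ℂ Icc (-y) y := by
    rw [hU, closure_reProdIm, closure_Ioo (by linarith)]
  have hUo : IsOpen U := isOpen_Ioo.reProdIm isOpen_Ioo
  have hmap : ∀ k : ℂ, k = 1 ∨ k = -1 ∨ k = I ∨ k = -I →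
      DiffContOnCl ℂ (fun z => f (c + k * z)) U := by
    intro k hk
    constructor
    · refine hd.comp (by fun_prop) ?_
      rintro z ⟨⟨h1, h2⟩, h3, h4⟩
      rcases hk with rfl | rfl | rfl | rfl <;> constructor <;> simp <;> linarith
    · rw [hcl]
      refine hc.comp (by fun_prop) ?_
      rintro z ⟨⟨h1, h2⟩, h3, h4⟩
      rcases hk with rfl | rfl | rfl | rfl <;> constructor <;> simp <;> linarith
  have hreal : ∀ u : ℂ, u.im = 0 → f u = 0 := by
    intro u hu
    rw [← h0 u.re]; congr 1; apply Complex.ext <;> simp [hu]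
  have key := Complex.norm_le_of_forall_mem_frontier_norm_le (U := U)
    (f := fun z => f (c + 1 * z) * f (c + (-1) * z) * (f (c + I * z) * f (c + (-I) * z)))
    (C := 0) ?_ ?_ ?_ (z := 0) ?_
  · have : f c * f c * (f c * f c) = 0 := norm_le_zero_iff.1 (by simpa using key)
    simpa using this
  · exact (isBounded_Ioo _ _).reProdIm (isBounded_Ioo _ _)
  · exact ((hmap 1 (by simp)).smul (hmap (-1) (by simp))).smul
      ((hmap I (by simp)).smul (hmap (-I) (by simp)))
  · intro z hz
    rw [frontier, hcl, hUo.interior_eq] at hz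
    obtain ⟨⟨⟨h1, h2⟩, h3, h4⟩, h5⟩ := hz
    have h6 : z.re = -y ∨ z.re = y ∨ z.im = -y ∨ z.im = y := by
      by_contra! h
      exact h5 ⟨⟨lt_of_le_of_ne h1 h.1.symm, lt_of_le_of_ne h2 h.2.1⟩,
        lt_of_le_of_ne h3 h.2.2.1.symm, lt_of_le_of_ne h4 h.2.2.2⟩
    rw [norm_le_zero_iff]
    rcases h6 with h | h | h | h
    · rw [hreal (c + I * z) (by simp [h, ← hy])]; simp
    · rw [hreal (c + (-I) * z) (by simp [h, ← hy])]; simp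
    · rw [hreal (c + 1 * z) (by simp [h, ← hy])]; simp
    · rw [hreal (c + (-1) * z) (by simp [h, ← hy])]; simp
  · rw [hcl]
    constructor <;> constructor <;> simp <;> linarith

/-- A continuous function on the closed strip that is holomorphic in the open strip and vanishes on
the real line is zero. -/
lemma eqOn_zero_closedStrip {f : ℂ → ℂ} (hc : ContinuousOn f closedStrip)
    (hd : DifferentiableOn ℂ f openStrip) (h0 : ∀ t : ℝ, f t = 0) : EqOn f 0 closedStrip := by
  have h1 : EqOn f 0 openStrip := by
    have hq : I * (Real.pi / 4 : ℝ) ∈ openStrip := by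
      constructor <;> simp <;> linarith [Real.pi_pos]
    refine (hd.analyticOnNhd isOpen_openStrip).eqOn_zero_of_preconnected_of_eventuallyEq_zero
      convex_openStrip.isPreconnected hq ?_
    have hopen : IsOpen {z : ℂ | 0 < z.im ∧ 2 * z.im < Real.pi} :=
      (isOpen_lt continuous_const continuous_im).inter
        (isOpen_lt (continuous_const.mul continuous_im) continuous_const)
    filter_upwards [hopen.mem_nhds (x := I * (Real.pi / 4 : ℝ))
      (by constructor <;> simp <;> linarith [Real.pi_pos])] with z hz
    exact eq_zero_of_square hc hd h0 hz.1 hz.2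
  intro z hz
  have hcw := (hc z hz).mono openStrip_subset_closedStrip
  have := mem_closure_iff_nhdsWithin_neBot.1 (closedStrip_subset_closure hz)
  refine tendsto_nhds_unique hcw (tendsto_const_nhds.congr' ?_)
  filter_upwards [self_mem_nhdsWithin] with u hu
  exact (h1 hu).symm

end StdSub

end

noncomputable section

namespace StdSub

open Filter Topology Set Metric

/-! ### The functions `c (1 - c) ((1 - c) / c) ^ w` on the unit interval -/

/-- The function `c ↦ c (1 - c) ((1 - c) / c) ^ w`. -/
def powFun (w c : ℂ) : ℂ :=
  ((c.re * (1 - c.re) : ℝ) : ℂ) * (((1 - c.re) / c.re : ℝ) : ℂ) ^ w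

/-- The unit interval in the complex plane. -/
def unitSegment : Set ℂ := Complex.ofReal '' Icc 0 1

lemma forall_unitSegment {p : ℂ → Prop} (h0 : p 0) (h1 : p 1)
    (h : ∀ x : ℝ, 0 < x → x < 1 → p x) : ∀ c ∈ unitSegment, p c := by
  rintro _ ⟨x, ⟨hx0, hx1⟩, rfl⟩
  rcases hx0.eq_or_lt with rfl | hx0
  · simpa using h0
  rcases hx1.eq_or_lt with rfl | hx1
  · simpa using h1
  exact h x hx0 hx1

@[simp] lemma powFun_zero_right (w : ℂ) : powFun w 0 = 0 := by simp [powFun]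

@[simp] lemma powFun_one_right (w : ℂ) : powFun w 1 = 0 := by simp [powFun]

lemma powFun_zero_left (x : ℝ) : powFun 0 x = x * (1 - x) := by simp [powFun]

lemma powFun_eq_exp (w : ℂ) {x : ℝ} (hx0 : 0 < x) (hx1 : x < 1) :
    powFun w x = ((x * (1 - x) : ℝ) : ℂ) * exp (Real.log ((1 - x) / x) * w) := by
  have hr : 0 < (1 - x) / x := div_pos (by linarith) hx0
  rw [powFun, ofReal_re, cpow_def_of_ne_zero (ofReal_ne_zero.2 hr.ne'), ofReal_log hr.le]

/-- Both exponents 1 - w and 1 + w have positive real part, which makes continuity at the endpoints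
0 and 1 visible. -/
lemma powFun_eq_cpow {w : ℂ} (hw : |w.re| < 1) :
    ∀ c ∈ unitSegment, powFun w c = (c.re : ℂ) ^ (1 - w) * ((1 - c.re : ℝ) : ℂ) ^ (1 + w) := by
  have h1 : 1 - w ≠ 0 := fun h => by
    have := congrArg re h; simp at this; rw [abs_lt] at hw; linarith
  have h2 : 1 + w ≠ 0 := fun h => by
    have := congrArg re h; simp at this; rw [abs_lt] at hw; linarith
  refine forall_unitSegment (by simp [h1]) (by simp [h2]) fun x hx0 hx1 => ?_
  have hx2 : 0 < 1 - x := by linarith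
  rw [powFun, ofReal_re, cpow_sub _ _ (ofReal_ne_zero.2 hx0.ne'),
    cpow_add _ _ (ofReal_ne_zero.2 hx2.ne'), ofReal_div,
    div_cpow_ofReal_nonneg hx2.le hx0.le, cpow_one, cpow_one]
  push_cast
  ring

lemma continuousOn_powFun {w : ℂ} (hw : |w.re| < 1) : ContinuousOn (powFun w) unitSegment := by
  rw [abs_lt] at hw
  refine ContinuousOn.congr (Continuous.continuousOn ?_) (powFun_eq_cpow (abs_lt.2 hw))
  refine Continuous.mul ?_ ?_
  · exact (continuous_ofReal_cpow_const (by simp; linarith)).comp continuous_re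
  · exact (continuous_ofReal_cpow_const (by simp; linarith)).comp
      (continuous_const.sub continuous_re)

/-- With r = (1 - x)/x one has r^{Re w} ≤ r + 1/r, and x(1 - x)(r + 1/r) = (1 - x)² + x² ≤ 1. -/
lemma norm_powFun_le {w : ℂ} (hw : |w.re| ≤ 1) : ∀ c ∈ unitSegment, ‖powFun w c‖ ≤ 1 := by
  refine forall_unitSegment (by simp) (by simp) fun x hx0 hx1 => ?_
  have hx2 : 0 < 1 - x := by linarith
  have hr : 0 < (1 - x) / x := div_pos hx2 hx0
  rw [powFun_eq_exp w hx0 hx1, norm_mul, norm_exp, norm_real, Real.norm_of_nonneg (by positivity),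
    re_ofReal_mul]
  set L := Real.log ((1 - x) / x) with hL
  have h1 : L * w.re ≤ |L| := by
    refine (le_abs_self _).trans ?_
    rw [abs_mul]
    exact mul_le_of_le_one_right (abs_nonneg _) hw
  have h2 : Real.exp (L * w.re) ≤ Real.exp L + Real.exp (-L) := by
    refine (Real.exp_le_exp.2 h1).trans ?_
    rcases abs_cases L with h | h <;> rw [h.1] <;> linarith [Real.exp_pos L, Real.exp_pos (-L)]
  have h3 : x * (1 - x) * (Real.exp L + Real.exp (-L)) = (1 - x) ^ 2 + x ^ 2 := by
    rw [Real.exp_neg, hL, Real.exp_log hr]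
    field_simp
  calc x * (1 - x) * Real.exp (L * w.re) ≤ x * (1 - x) * (Real.exp L + Real.exp (-L)) := by
        gcongr
    _ = (1 - x) ^ 2 + x ^ 2 := h3
    _ ≤ 1 := by nlinarith

lemma differentiable_powFun : ∀ c ∈ unitSegment, Differentiable ℂ fun w => powFun w c := by
  refine forall_unitSegment (by simp) (by simp) fun x hx0 hx1 => ?_
  have : (fun w => powFun w x) =
      fun w => ((x * (1 - x) : ℝ) : ℂ) * exp (Real.log ((1 - x) / x) * w) := by
    ext w; exact powFun_eq_exp w hx0 hx1
  rw [this]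
  fun_prop

/-- The group law of the powers of Δ. It compares two products, since each power carries its own
regularizing factor. -/
lemma powFun_mul_powFun {w w' v v' : ℂ} (h : w + w' = v + v') :
    ∀ c ∈ unitSegment, powFun w c * powFun w' c = powFun v c * powFun v' c := by
  refine forall_unitSegment (by simp) (by simp) fun x hx0 hx1 => ?_
  simp only [powFun_eq_exp _ hx0 hx1]
  rw [mul_mul_mul_comm, ← exp_add, ← mul_add, h, mul_add, exp_add, mul_mul_mul_comm]

lemma conj_powFun (w : ℂ) : ∀ c ∈ unitSegment, star (powFun w c) = powFun (star w) c := by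
  refine forall_unitSegment (by simp) (by simp) fun x hx0 hx1 => ?_
  simp only [powFun_eq_exp _ hx0 hx1]
  simp [← exp_conj]

/-- The reflection c ↦ 1 - c inverts the spectral value (1 - c)/c of Δ; this is the source of JΔ^wJ
= Δ^{-w̄}. -/
lemma powFun_one_sub (w : ℂ) : ∀ c ∈ unitSegment, powFun w (1 - c) = powFun (-w) c := by
  refine forall_unitSegment (by simp) (by simp) fun x hx0 hx1 => ?_
  have hx2 : 0 < 1 - x := by linarith
  rw [show (1 - (x : ℂ)) = ((1 - x : ℝ) : ℂ) by push_cast; rfl,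
    powFun_eq_exp w hx2 (by linarith), powFun_eq_exp (-w) hx0 hx1, sub_sub_cancel, mul_comm (1 - x),
    mul_neg, ← neg_mul, ← ofReal_neg, ← Real.log_inv, inv_div]

lemma one_sub_mem_unitSegment {c : ℂ} (hc : c ∈ unitSegment) : 1 - c ∈ unitSegment := by
  obtain ⟨x, ⟨h0, h1⟩, rfl⟩ := hc
  exact ⟨1 - x, ⟨by linarith, by linarith⟩, by push_cast; rfl⟩

/-- The square root of `c (1 - c)`. -/
def sqrtFun (c : ℂ) : ℂ := ((√(c.re * (1 - c.re)) : ℝ) : ℂ)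

lemma continuous_sqrtFun : Continuous sqrtFun := by unfold sqrtFun; fun_prop

lemma sqrtFun_mul_self : ∀ c ∈ unitSegment, sqrtFun c * sqrtFun c = powFun 0 c := by
  rintro _ ⟨x, ⟨h0, h1⟩, rfl⟩
  rw [sqrtFun, ← ofReal_mul, Real.mul_self_sqrt (by simp only [ofReal_re]; nlinarith), powFun]
  simp

lemma sqrtFun_one_sub : ∀ c ∈ unitSegment, sqrtFun (1 - c) = sqrtFun c := by
  rintro _ ⟨x, -, rfl⟩
  simp [sqrtFun, mul_comm]

lemma sqrtFun_mul_one_sub : ∀ c ∈ unitSegment, sqrtFun c * (1 - c) = powFun (1 / 2) c := by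
  refine forall_unitSegment (by simp [sqrtFun]) (by simp) fun x hx0 hx1 => ?_
  have hx2 : 0 < 1 - x := by linarith
  rw [sqrtFun, powFun, ofReal_re, show (1 / 2 : ℂ) = ((1 / 2 : ℝ) : ℂ) by push_cast; rfl,
    ← ofReal_cpow (div_pos hx2 hx0).le, ← ofReal_one, ← ofReal_sub, ← ofReal_mul, ← ofReal_mul,
    ← Real.sqrt_eq_rpow, Real.sqrt_mul hx0.le, Real.sqrt_div hx2.le]
  congr 1
  have := Real.sq_sqrt hx0.le
  have h3 : √x ≠ 0 := (Real.sqrt_pos.2 hx0).ne'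
  field_simp
  rw [this]

/-- The function `(c (1 - c) + δ)⁻¹`. -/
def regFun (δ : ℝ) (c : ℂ) : ℂ := (((c.re * (1 - c.re) + δ)⁻¹ : ℝ) : ℂ)

lemma continuousOn_regFun {δ : ℝ} (hδ : 0 < δ) : ContinuousOn (regFun δ) unitSegment := by
  refine continuous_ofReal.comp_continuousOn (ContinuousOn.inv₀ (by fun_prop) ?_)
  rintro _ ⟨x, ⟨h0, h1⟩, rfl⟩
  have : 0 ≤ x * (1 - x) := mul_nonneg h0 (by linarith)
  simp only [ofReal_re]
  positivity

lemma one_sub_regFun {δ : ℝ} (hδ : 0 < δ) :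
    ∀ c ∈ unitSegment, 1 - powFun 0 c * regFun δ c = δ * regFun δ c := by
  rintro _ ⟨x, ⟨h0, h1⟩, rfl⟩
  have : 0 ≤ x * (1 - x) := mul_nonneg h0 (by linarith)
  have h2 : x * (1 - x) + δ ≠ 0 := by positivity
  have h3 : (x : ℂ) * (1 - x) + δ ≠ 0 := by exact_mod_cast h2
  rw [powFun_zero_left, regFun]
  push_cast
  simp only [ofReal_re]
  field_simp
  ring

lemma norm_smul_regFun_le {δ : ℝ} (hδ : 0 < δ) :
    ∀ c ∈ unitSegment, ‖δ * regFun δ c‖ ≤ 1 ∧ ‖powFun 0 c * regFun δ c‖ ≤ 1 := by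
  rintro _ ⟨x, ⟨h0, h1⟩, rfl⟩
  have : 0 ≤ x * (1 - x) := mul_nonneg h0 (by linarith)
  have h2 : 0 < x * (1 - x) + δ := by positivity
  rw [powFun_zero_left, regFun, ← ofReal_one, ← ofReal_sub, ← ofReal_mul, ← ofReal_mul,
    ← ofReal_mul, norm_real, norm_real, ofReal_re, Real.norm_of_nonneg (by positivity),
    Real.norm_of_nonneg (by positivity), ← div_eq_mul_inv, ← div_eq_mul_inv, div_le_one h2,
    div_le_one h2]
  exact ⟨by linarith, by linarith⟩

end StdSub

end

noncomputable section

namespace StdSub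

open Filter Topology Set Metric ContinuousLinearMap

/-! ### Regularized powers -/

variable {H : Type*} [NormedAddCommGroup H] [InnerProductSpace ℂ H] [CompleteSpace H]

/-- A selfadjoint operator `0 ≤ C ≤ 1` with `C (1 - C)` injective, that is, the resolvent
`(1 + T)⁻¹` of an injective positive operator `T`. -/
structure IsPosResolvent (C : H →L[ℂ] H) : Prop where
  isSelfAdjoint : IsSelfAdjoint C
  spectrum_subset : spectrum ℂ C ⊆ unitSegment
  injective : Function.Injective ⇑(C * (1 - C))

/-- The regularized power `C (1 - C) T ^ w`, where `C = (1 + T)⁻¹`. -/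
def regPow (C : H →L[ℂ] H) (w : ℂ) : H →L[ℂ] H := cfc (powFun w) C

/-- The operator `(C (1 - C)) ^ (1/2)`. -/
def sqrtOp (C : H →L[ℂ] H) : H →L[ℂ] H := cfc sqrtFun C

/-- The operator `(C (1 - C) + δ)⁻¹`. -/
def regOp (C : H →L[ℂ] H) (δ : ℝ) : H →L[ℂ] H := cfc (regFun δ) C

omit [CompleteSpace H] in
lemma denseRange_of_forall_inner {T S : H →L[ℂ] H} [CompleteSpace H]
    (hTS : ∀ x y, ⟪x, T y⟫ = ⟪S x, y⟫) (hS : Function.Injective S) : DenseRange T := by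
  have h := T.orthogonal_range
  have h2 : (adjoint T).ker = ⊥ := by
    refine LinearMap.ker_eq_bot.2 ?_
    rwa [← (eq_adjoint_iff S T).2 (fun x y => (hTS x y).symm)]
  rw [h2, ← Submodule.topologicalClosure_eq_top_iff] at h
  exact Submodule.dense_iff_topologicalClosure_eq_top.2 h

omit [CompleteSpace H] in
lemma eq_of_comp_denseRange {X Y T : H →L[ℂ] H} (hT : DenseRange T) (h : X * T = Y * T) :
    X = Y := by
  ext x
  refine congrFun (hT.equalizer X.continuous Y.continuous ?_) x
  ext y
  exact DFunLike.congr_fun h y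

omit [CompleteSpace H] in
lemma eq_of_comp_injective {X Y T : H →L[ℂ] H} (hT : Function.Injective T) (h : T * X = T * Y) :
    X = Y := by
  ext x
  exact hT (DFunLike.congr_fun h x)

namespace IsPosResolvent

variable {C : H →L[ℂ] H} (hC : IsPosResolvent C)
include hC

lemma isStarNormal : IsStarNormal C := hC.isSelfAdjoint.isStarNormal

lemma continuousOn {w : ℂ} (hw : |w.re| < 1) : ContinuousOn (powFun w) (spectrum ℂ C) :=
  (continuousOn_powFun hw).mono hC.spectrum_subset

lemma cfc_congr {f g : ℂ → ℂ} (h : ∀ c ∈ unitSegment, f c = g c) : cfc f C = cfc g C :=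
  _root_.cfc_congr fun c hc => h c (hC.spectrum_subset hc)

lemma regPow_zero : regPow C 0 = C * (1 - C) := by
  have := hC.isStarNormal
  rw [regPow, hC.cfc_congr (g := fun c => c * (1 - c))
    (by rintro _ ⟨x, -, rfl⟩; exact powFun_zero_left x),
    cfc_mul _ _ C, cfc_sub _ _ C, cfc_id' ℂ C, cfc_const_one ℂ C]

lemma regPow_mul_regPow {w w' v v' : ℂ} (hw : |w.re| < 1) (hw' : |w'.re| < 1) (hv : |v.re| < 1)
    (hv' : |v'.re| < 1) (h : w + w' = v + v') :
    regPow C w * regPow C w' = regPow C v * regPow C v' := by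
  unfold regPow
  rw [← cfc_mul _ _ C (hC.continuousOn hw) (hC.continuousOn hw'),
    ← cfc_mul _ _ C (hC.continuousOn hv) (hC.continuousOn hv')]
  exact hC.cfc_congr (powFun_mul_powFun h)

omit hC in
lemma regPow_commute (w w' : ℂ) : Commute (regPow C w) (regPow C w') := cfc_commute_cfc _ _ _

omit hC in
lemma regOp_commute (δ : ℝ) (w : ℂ) : Commute (regOp C δ) (regPow C w) := cfc_commute_cfc _ _ _

lemma star_regPow (w : ℂ) : star (regPow C w) = regPow C (star w) := by
  rw [regPow, ← cfc_star]
  exact hC.cfc_congr (conj_powFun w)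

lemma adjoint_regPow (w : ℂ) : adjoint (regPow C w) = regPow C (star w) := hC.star_regPow w

lemma inner_regPow (w : ℂ) (x y : H) : ⟪x, regPow C w y⟫ = ⟪regPow C (star w) x, y⟫ := by
  rw [← hC.adjoint_regPow, adjoint_inner_left]

lemma inner_regPow_zero (x y : H) : ⟪x, regPow C 0 y⟫ = ⟪regPow C 0 x, y⟫ := by
  rw [hC.inner_regPow, star_zero]

lemma regPow_zero_injective : Function.Injective (regPow C 0) := by
  rw [hC.regPow_zero]; exact hC.injective

lemma regPow_injective {w : ℂ} (hw : |w.re| < 1) : Function.Injective (regPow C w) := by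
  have h : regPow C (-w) * regPow C w = regPow C 0 * regPow C 0 :=
    hC.regPow_mul_regPow (by simpa using hw) hw (by simp) (by simp) (by simp)
  have h2 : Function.Injective ⇑(regPow C (-w) * regPow C w) := by
    rw [h]; exact hC.regPow_zero_injective.comp hC.regPow_zero_injective
  exact Function.Injective.of_comp (f := regPow C (-w)) h2

lemma regPow_denseRange {w : ℂ} (hw : |w.re| < 1) : DenseRange (regPow C w) :=
  denseRange_of_forall_inner (hC.inner_regPow w) (hC.regPow_injective (by simpa using hw))

lemma norm_cfc_le_of_forall {f : ℂ → ℂ} {K : ℝ} (hK : 0 ≤ K)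
    (h : ∀ c ∈ unitSegment, ‖f c‖ ≤ K) : ‖cfc f C‖ ≤ K :=
  norm_cfc_le hK fun c hc => h c (hC.spectrum_subset hc)

/-- The functional calculus carries slopes to slopes. The scalar functions w ↦ `powFun w c` are
bounded by 1 for all c in the unit interval, so their slopes oscillate uniformly little. -/
lemma differentiableOn_regPow : DifferentiableOn ℂ (regPow C) {w | |w.re| < 1} := by
  have hopen : IsOpen {w : ℂ | |w.re| < 1} :=
    isOpen_lt (continuous_abs.comp continuous_re) continuous_const
  intro w hw
  obtain ⟨R, hR, hball⟩ := Metric.isOpen_iff.1 hopen w hw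
  refine (differentiableAt_of_norm_slope_sub_slope_le (K := 4 * 1 / R ^ 2) hR
    fun z hz z' hz' hzw hzw' => ?_).differentiableWithinAt
  have hc := hC.continuousOn hw
  have key : ∀ z ∈ ball w R, slope (regPow C) w z = cfc (fun c => slope (powFun · c) w z) C := by
    intro z hz
    have hcz := hC.continuousOn (hball hz)
    simp only [slope_def_module]
    have := cfc_const_mul (z - w)⁻¹ (fun c => powFun z c - powFun w c) C (hcz.sub hc)
    rw [cfc_sub _ _ C hcz hc] at this
    exact this.symm
  have hsc : ∀ z ∈ ball w R, ContinuousOn (fun c => slope (powFun · c) w z) (spectrum ℂ C) := by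
    intro z hz
    simp only [slope_def_module]
    exact ((hC.continuousOn (hball hz)).sub hc).const_smul (z - w)⁻¹
  rw [key z hz, key z' hz', ← cfc_sub _ _ C (hsc z hz) (hsc z' hz')]
  refine hC.norm_cfc_le_of_forall (by positivity) fun c hc => ?_
  exact norm_slope_sub_slope_le (differentiable_powFun c hc).differentiableOn
    (fun z hz => norm_powFun_le (hball hz).le c hc) hz hz' hzw hzw'

lemma norm_regPow_le {w : ℂ} (hw : |w.re| ≤ 1) : ‖regPow C w‖ ≤ 1 :=
  hC.norm_cfc_le_of_forall zero_le_one (norm_powFun_le hw)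

/-- Unitarity of Δ^{is}, tested on the range of R_0. -/
lemma norm_regPow_I_mul (s : ℝ) (x : H) : ‖regPow C (I * s) x‖ = ‖regPow C 0 x‖ := by
  have h : regPow C (star (I * s)) * regPow C (I * s) = regPow C 0 * regPow C 0 :=
    hC.regPow_mul_regPow (by simp) (by simp) (by simp) (by simp) (by simp)
  have h1 : ⟪regPow C (I * s) x, regPow C (I * s) x⟫ = ⟪regPow C 0 x, regPow C 0 x⟫ := by
    rw [hC.inner_regPow, hC.inner_regPow_zero, ← mul_apply_eq_comp, h]
    rfl
  rw [inner_self_eq_norm_sq_to_K, inner_self_eq_norm_sq_to_K] at h1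
  have h2 : ‖regPow C (I * s) x‖ ^ 2 = ‖regPow C 0 x‖ ^ 2 := by exact_mod_cast h1
  exact (sq_eq_sq₀ (norm_nonneg _) (norm_nonneg _)).1 h2

/-! #### The square root -/

lemma sqrtOp_mul_self : sqrtOp C * sqrtOp C = regPow C 0 := by
  rw [sqrtOp, ← cfc_mul _ _ C continuous_sqrtFun.continuousOn continuous_sqrtFun.continuousOn]
  exact hC.cfc_congr sqrtFun_mul_self

lemma sqrtOp_mul_one_sub : sqrtOp C * (1 - C) = regPow C (1 / 2) := by
  have := hC.isStarNormal
  have h : (1 : H →L[ℂ] H) - C = cfc (fun c : ℂ => 1 - c) C := by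
    rw [cfc_sub _ _ C, cfc_id' ℂ C, cfc_const_one ℂ C]
  rw [h, sqrtOp, ← cfc_mul _ _ C continuous_sqrtFun.continuousOn]
  exact hC.cfc_congr sqrtFun_mul_one_sub

lemma sqrtOp_commute : Commute (sqrtOp C) C := by
  have := hC.isStarNormal
  have := cfc_commute_cfc sqrtFun (fun c : ℂ => c) C
  rwa [cfc_id' ℂ C] at this

lemma isSelfAdjoint_sqrtOp : IsSelfAdjoint (sqrtOp C) := by
  rw [IsSelfAdjoint, sqrtOp, ← cfc_star]
  exact hC.cfc_congr fun c _ => by simp [sqrtFun]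

lemma inner_sqrtOp (x y : H) : ⟪x, sqrtOp C y⟫ = ⟪sqrtOp C x, y⟫ := by
  conv_rhs => rw [← hC.isSelfAdjoint_sqrtOp.star_eq]
  exact (adjoint_inner_left _ _ _).symm

lemma sqrtOp_injective : Function.Injective (sqrtOp C) := by
  have h2 : Function.Injective ⇑(sqrtOp C * sqrtOp C) := by
    rw [hC.sqrtOp_mul_self]; exact hC.regPow_zero_injective
  exact Function.Injective.of_comp (f := sqrtOp C) h2

lemma sqrtOp_denseRange : DenseRange (sqrtOp C) :=
  denseRange_of_forall_inner hC.inner_sqrtOp hC.sqrtOp_injective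

/-! #### Approximate units -/

lemma continuousOn_regFun' {δ : ℝ} (hδ : 0 < δ) : ContinuousOn (regFun δ) (spectrum ℂ C) :=
  (continuousOn_regFun hδ).mono hC.spectrum_subset

lemma one_sub_regOp {δ : ℝ} (hδ : 0 < δ) : 1 - regPow C 0 * regOp C δ = (δ : ℂ) • regOp C δ := by
  have := hC.isStarNormal
  have h1 := hC.continuousOn_regFun' hδ
  have h2 := hC.continuousOn (w := 0) (by simp)
  unfold regPow regOp
  rw [← cfc_const_mul (δ : ℂ) (regFun δ) C h1, ← cfc_mul _ _ C h2 h1, ← cfc_const_one ℂ C,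
    ← cfc_sub (fun _ => 1) (fun c => powFun 0 c * regFun δ c) C continuousOn_const (h2.mul h1)]
  exact hC.cfc_congr (one_sub_regFun hδ)

lemma norm_smul_regOp_le {δ : ℝ} (hδ : 0 < δ) : ‖(δ : ℂ) • regOp C δ‖ ≤ 1 := by
  unfold regOp
  rw [← cfc_const_mul (δ : ℂ) (regFun δ) C (hC.continuousOn_regFun' hδ)]
  exact hC.norm_cfc_le_of_forall zero_le_one fun c hc => (norm_smul_regFun_le hδ c hc).1

lemma norm_regPow_mul_regOp_le {δ : ℝ} (hδ : 0 < δ) : ‖regPow C 0 * regOp C δ‖ ≤ 1 := by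
  unfold regOp regPow
  rw [← cfc_mul _ _ C (hC.continuousOn (by simp)) (hC.continuousOn_regFun' hδ)]
  exact hC.norm_cfc_le_of_forall zero_le_one fun c hc => (norm_smul_regFun_le hδ c hc).2

/-- The operators are contractions, and at a vector R_0 y of the dense range they are at most δ‖y‖.
By `one_sub_regOp` this says that R_0 (R_0 + δ)⁻¹ tends strongly to 1. -/
lemma tendsto_smul_regOp (x : H) :
    Tendsto (fun δ : ℝ => ((δ : ℂ) • regOp C δ) x) (𝓝[>] 0) (𝓝 0) := by
  rw [Metric.tendsto_nhds]
  intro ε hε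
  obtain ⟨y, hy⟩ := (hC.regPow_denseRange (w := 0) (by simp)).exists_dist_lt x (half_pos hε)
  have hδ : ∀ᶠ δ : ℝ in 𝓝[>] 0, δ * ‖y‖ < ε / 2 := by
    have : Tendsto (fun δ : ℝ => δ * ‖y‖) (𝓝[>] 0) (𝓝 (0 * ‖y‖)) :=
      (tendsto_id.mono_left nhdsWithin_le_nhds).mul_const _
    rw [zero_mul] at this
    exact this.eventually_lt_const (half_pos hε)
  filter_upwards [hδ, self_mem_nhdsWithin] with δ h1 h2
  rw [dist_zero_right]
  have e1 : ‖((δ : ℂ) • regOp C δ) (x - regPow C 0 y)‖ ≤ ‖x - regPow C 0 y‖ :=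
    (le_opNorm _ _).trans (mul_le_of_le_one_left (norm_nonneg _) (hC.norm_smul_regOp_le h2))
  have e2 : ‖((δ : ℂ) • regOp C δ) (regPow C 0 y)‖ ≤ δ * ‖y‖ := by
    have : ((δ : ℂ) • regOp C δ) (regPow C 0 y) = (δ : ℂ) • ((regPow C 0 * regOp C δ) y) := by
      rw [← (regOp_commute δ 0).eq]; rfl
    rw [this, norm_smul, norm_real, Real.norm_of_nonneg (le_of_lt h2)]
    exact mul_le_mul_of_nonneg_left ((le_opNorm _ _).trans
      (mul_le_of_le_one_left (norm_nonneg _) (hC.norm_regPow_mul_regOp_le h2))) (le_of_lt h2)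
  rw [dist_eq_norm] at hy
  calc ‖((δ : ℂ) • regOp C δ) x‖
      = ‖((δ : ℂ) • regOp C δ) (x - regPow C 0 y) + ((δ : ℂ) • regOp C δ) (regPow C 0 y)‖ := by
        rw [← map_add, sub_add_cancel]
    _ < ε := by
        refine (norm_add_le _ _).trans_lt ?_
        linarith

end IsPosResolvent

/-! ### Antilinear intertwiners -/

/-- Stone–Weierstrass: the functions g with S g(M) = ḡ(N) S contain the constants, the identity and
its conjugate, and are closed under sums, products and uniform limits. The union of the spectra lets
one function algebra serve both calculi. -/
lemma antilinear_intertwines_cfc {S : H →L⋆[ℂ] H} {M N : H →L[ℂ] H} (hM : IsSelfAdjoint M)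
    (hN : IsSelfAdjoint N) (h : ∀ x, S (M x) = N (S x)) {f : ℂ → ℂ}
    (hf : ContinuousOn f (spectrum ℂ M ∪ spectrum ℂ N)) (x : H) :
    S (cfc f M x) = cfc (fun c => star (f c)) N (S x) := by
  set s := spectrum ℂ M ∪ spectrum ℂ N with hs
  have hM' := hM.isStarNormal
  have hN' := hN.isStarNormal
  have : CompactSpace s := isCompact_iff_compactSpace.1
    ((spectrum.isCompact M).union (spectrum.isCompact N))
  set Φ := cfcHomSuperset (R := ℂ) hM' (subset_union_left : _ ⊆ s) with hΦ
  set Ψ := cfcHomSuperset (R := ℂ) hN' (subset_union_right : _ ⊆ s) with hΨ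
  have hΦc : Continuous Φ := cfcHomSuperset_continuous hM' _
  have hΨc : Continuous Ψ := cfcHomSuperset_continuous hN' _
  have hΦid : Φ (.restrict s <| .id ℂ) = M := cfcHomSuperset_id hM' _
  have hΨid : Ψ (.restrict s <| .id ℂ) = N := cfcHomSuperset_id hN' _
  have key : ∀ g : C(s, ℂ), ∀ x, S (Φ g x) = Ψ (star g) (S x) := by
    intro g
    induction g using ContinuousMap.induction_on_of_compact with
    | const r =>
      intro x
      have e1 : (ContinuousMap.const s r) = algebraMap ℂ C(s, ℂ) r := rfl
      rw [e1, ← algebraMap_star_comm, AlgHomClass.commutes, AlgHomClass.commutes]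
      simp [Algebra.algebraMap_eq_smul_one]
    | id => intro x; rw [map_star, hΦid, hΨid, hN.star_eq, h]
    | star_id => intro x; rw [star_star, map_star, hΦid, hΨid, hM.star_eq, h]
    | add f g hf hg => intro x; simp [hf, hg]
    | mul f g hf hg =>
      intro x
      rw [star_mul', map_mul, map_mul, mul_apply_eq_comp, mul_apply_eq_comp, hf, hg]
    | frequently f hfr =>
      refine hfr.mem_of_closed (s := {g | ∀ x, S (Φ g x) = Ψ (star g) (S x)}) ?_
      simp only [ofPred_forall]
      refine isClosed_iInter fun x => isClosed_eq ?_ ?_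
      · exact S.continuous.comp (hΦc.clm_apply continuous_const)
      · exact (hΨc.comp continuous_star).clm_apply continuous_const
  have := key ⟨_, hf.domRestrict⟩ x
  rw [cfc_apply f M hM' (hf.mono subset_union_left),
    cfc_apply (fun c => star (f c)) N hN' ((continuous_star.comp_continuousOn hf).mono
      subset_union_right)]
  exact this

end StdSub

end

/-! ### The resolvent of Δ, built from the real projection onto V. -/

noncomputable section

namespace StdSub

open Filter Topology Set Metric ContinuousLinearMap

variable {H : Type*} [NormedAddCommGroup H] [InnerProductSpace ℂ H]

/-! ### Real-linear maps that are linear or antilinear -/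

lemma complex_smul_eq (c : ℂ) (y : H) : c • y = c.re • y + c.im • I • y := by
  simp only [← Complex.coe_smul]
  match_scalars
  simp

lemma inner_self_eq_ofReal (x : H) : ⟪x, x⟫ = ((‖x‖ ^ 2 : ℝ) : ℂ) := by
  rw [inner_self_eq_norm_sq_to_K]; push_cast; rfl

lemma injective_of_apply_eq_zero {T : H →L[ℂ] H} (h : ∀ x, T x = 0 → x = 0) :
    Function.Injective T := (injective_iff_map_eq_zero T).2 h

/-- A real-linear map that commutes with `I`, as a complex-linear map. -/
def linearOfReal (f : H →L[ℝ] H) (hf : ∀ x, f (I • x) = I • f x) : H →L[ℂ] H where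
  toFun := f
  map_add' := map_add f
  map_smul' c x := by
    rw [complex_smul_eq, map_add, map_smul, map_smul, hf, RingHom.id_apply, complex_smul_eq c (f x)]
  cont := f.continuous

/-- A real-linear map that anticommutes with `I`, as an antilinear map. -/
def antilinearOfReal (f : H →L[ℝ] H) (hf : ∀ x, f (I • x) = -(I • f x)) : H →L⋆[ℂ] H where
  toFun := f
  map_add' := map_add f
  map_smul' c x := by
    rw [complex_smul_eq, map_add, map_smul, map_smul, hf, complex_smul_eq (starRingEnd ℂ c) (f x)]
    simp
  cont := f.continuous

lemma inner_ext_of_re {x y x' y' : H} (h : ⟪x, y⟫.re = ⟪x', y'⟫.re)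
    (hI : ⟪x, I • y⟫.re = ⟪x', I • y'⟫.re) : ⟪x, y⟫ = ⟪x', y'⟫ := by
  refine Complex.ext h ?_
  simpa [inner_smul_right] using hI

variable [CompleteSpace H] (V : StandardSubspace H)

/-! ### The real orthogonal projection onto `V` -/

/-- The real orthogonal projection onto `V`. -/
def realProj : H →L[ℝ] H := V.toClosedSubmodule.toSubmodule.starProjection

lemma realProj_mem (x : H) : realProj V x ∈ V.toClosedSubmodule :=
  Submodule.starProjection_apply_mem _ x

lemma realProj_eq_self_iff {x : H} : realProj V x = x ↔ x ∈ V.toClosedSubmodule :=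
  Submodule.starProjection_eq_self_iff

lemma realProj_realProj (x : H) : realProj V (realProj V x) = realProj V x :=
  (realProj_eq_self_iff V).2 (realProj_mem V x)

lemma re_inner_realProj (x y : H) : ⟪x, realProj V y⟫.re = ⟪realProj V x, y⟫.re :=
  (Submodule.inner_starProjection_left_eq_right V.toClosedSubmodule.toSubmodule x y).symm

/-- The hypotheses make x real-orthogonal to both V and iV, hence to the dense subspace V + iV. -/
lemma eq_zero_of_realProj {x : H} (h1 : realProj V x = 0) (h2 : realProj V (I • x) = 0) :
    x = 0 := by
  have key : ∀ x, realProj V x = 0 → ∀ y ∈ V.toClosedSubmodule, ⟪y, x⟫.re = 0 := by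
    intro x hx y hy
    rw [← (realProj_eq_self_iff V).2 hy, ← re_inner_realProj, hx, inner_zero_right, zero_re]
  have hmem : x ∈ V.toClosedSubmoduleᗮ ⊓ V.toClosedSubmodule.mulIᗮ := by
    refine ⟨?_, ?_⟩
    · exact (ClosedSubmodule.mem_orthogonal _ _).2 fun y hy => key x h1 y hy
    · refine ClosedSubmodule.mem_symplComp_iff.2 fun y hy => ?_
      have := key _ h2 y hy
      simpa [inner_smul_right] using this
  rw [ClosedSubmodule.inf_orthogonal, V.IsCyclic, ClosedSubmodule.top_orthogonal_eq_bot] at hmem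
  simpa using hmem

omit [CompleteSpace H] in
lemma eq_zero_of_mem_of_I_smul_mem {x : H} (h1 : x ∈ V.toClosedSubmodule)
    (h2 : I • x ∈ V.toClosedSubmodule) : x = 0 := by
  have hmem : x ∈ V.toClosedSubmodule ⊓ V.toClosedSubmodule.mulI := by
    refine ⟨h1, (ClosedSubmodule.mem_mapEquiv_iff (scalarSMulCLE H UnitI) _ _).2 ?_⟩
    have : (scalarSMulCLE H UnitI).symm x = (-1 : ℝ) • (I • x) := by
      rw [scalarSMulCLE_symm_apply, Units.smul_def, Units.val_inv_eq_inv_val, Complex.val_UnitI,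
        inv_I, neg_smul, neg_one_smul]
    rw [this]
    exact SMulMemClass.smul_mem (-1 : ℝ) h2
  rw [V.IsSeparating] at hmem
  simpa using hmem

/-! ### The resolvent and the antilinear operator of `V` -/

/-- Half the sum of the real orthogonal projections onto `V` and `i V`; this is `(1 + Δ_V)⁻¹`. -/
def halfSum : H →L[ℂ] H :=
  linearOfReal ((1 / 2 : ℝ) • (realProj V -
    (scalarSMulCLE H UnitI : H →L[ℝ] H) ∘L realProj V ∘L (scalarSMulCLE H UnitI : H →L[ℝ] H)))
    fun x => by
      simp only [FunLike.coe_smul, FunLike.coe_sub, ContinuousLinearMap.coe_comp, Pi.smul_apply, Pi.sub_apply, Function.comp_apply,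
        ContinuousLinearEquiv.coe_coe, scalarSMulCLE_apply, Units.smul_def, val_UnitI]
      rw [smul_smul I I x, I_mul_I, neg_one_smul, map_neg]
      simp only [← Complex.coe_smul]
      match_scalars <;> apply Complex.ext <;> simp

/-- Half the difference of the real orthogonal projections onto `V` and `i V`; this is
`σ_V (1 + Δ_V)⁻¹`. -/
def halfDiff : H →L⋆[ℂ] H :=
  antilinearOfReal ((1 / 2 : ℝ) • (realProj V +
    (scalarSMulCLE H UnitI : H →L[ℝ] H) ∘L realProj V ∘L (scalarSMulCLE H UnitI : H →L[ℝ] H)))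
    fun x => by
      simp only [FunLike.coe_smul, FunLike.coe_add, ContinuousLinearMap.coe_comp, Pi.smul_apply, Pi.add_apply, Function.comp_apply,
        ContinuousLinearEquiv.coe_coe, scalarSMulCLE_apply, Units.smul_def, val_UnitI]
      rw [smul_smul I I x, I_mul_I, neg_one_smul, map_neg]
      simp only [← Complex.coe_smul]
      match_scalars <;> apply Complex.ext <;> simp

lemma halfSum_apply (x : H) :
    halfSum V x = (1 / 2 : ℝ) • (realProj V x - I • realProj V (I • x)) := rfl

lemma halfDiff_apply (x : H) :
    halfDiff V x = (1 / 2 : ℝ) • (realProj V x + I • realProj V (I • x)) := rfl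

lemma halfSum_add_halfDiff (x : H) : halfSum V x + halfDiff V x = realProj V x := by
  rw [halfSum_apply, halfDiff_apply]
  module

lemma halfSum_sub_halfDiff (x : H) :
    halfSum V x - halfDiff V x = -(I • realProj V (I • x)) := by
  rw [halfSum_apply, halfDiff_apply]
  module

lemma halfDiff_smul_I (x : H) : halfDiff V (I • x) = -(I • halfDiff V x) := by
  rw [map_smulₛₗ]; simp

/-- C - D and C + D are the real projections onto iV and V. Adding the two idempotency relations
gives D² = C - C²; subtracting them gives DC = D - CD. -/
lemma sub_idem (x : H) : halfSum V (halfSum V x - halfDiff V x) -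
    halfDiff V (halfSum V x - halfDiff V x) = halfSum V x - halfDiff V x := by
  rw [halfSum_sub_halfDiff V (halfSum V x - halfDiff V x), halfSum_sub_halfDiff, smul_neg,
    smul_smul, I_mul_I, neg_one_smul, neg_neg, realProj_realProj]

lemma add_idem (x : H) : halfSum V (halfSum V x + halfDiff V x) +
    halfDiff V (halfSum V x + halfDiff V x) = halfSum V x + halfDiff V x := by
  rw [halfSum_add_halfDiff V (halfSum V x + halfDiff V x), halfSum_add_halfDiff, realProj_realProj]

lemma halfDiff_halfDiff (x : H) :
    halfDiff V (halfDiff V x) = halfSum V x - halfSum V (halfSum V x) := by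
  have h1 := add_idem V x
  have h2 := sub_idem V x
  simp only [map_add, map_sub] at h1 h2
  have h3 : (2 : ℝ) • (halfSum V (halfSum V x) + halfDiff V (halfDiff V x)) =
      (2 : ℝ) • halfSum V x := by
    linear_combination (norm := module) h1 + h2
  have h4 := smul_right_injective H (two_ne_zero' ℝ) h3
  linear_combination (norm := module) h4

lemma halfDiff_halfSum (x : H) :
    halfDiff V (halfSum V x) = halfDiff V x - halfSum V (halfDiff V x) := by
  have h1 := add_idem V x
  have h2 := sub_idem V x
  simp only [map_add, map_sub] at h1 h2
  have h3 : (2 : ℝ) • (halfSum V (halfDiff V x) + halfDiff V (halfSum V x)) =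
      (2 : ℝ) • halfDiff V x := by
    linear_combination (norm := module) h1 - h2
  have h4 := smul_right_injective H (two_ne_zero' ℝ) h3
  linear_combination (norm := module) h4

lemma re_inner_I_smul_realProj (x y : H) :
    ⟪x, I • realProj V (I • y)⟫.re = ⟪I • realProj V (I • x), y⟫.re := by
  have h := re_inner_realProj V (I • x) (I • y)
  have h1 : ⟪x, I • realProj V (I • y)⟫ = -⟪I • x, realProj V (I • y)⟫ := by
    simp [mul_comm]
  have h2 : ⟪I • realProj V (I • x), y⟫ = -⟪realProj V (I • x), I • y⟫ := by
    simp [mul_comm]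
  rw [h1, h2, neg_re, neg_re, h]

lemma re_inner_halfSum (x y : H) : ⟪x, halfSum V y⟫.re = ⟪halfSum V x, y⟫.re := by
  have h1 := re_inner_realProj V x y
  have h2 := re_inner_I_smul_realProj V x y
  rw [halfSum_apply, halfSum_apply, ← Complex.coe_smul, ← Complex.coe_smul, inner_smul_right,
    inner_smul_left, conj_ofReal, re_ofReal_mul, re_ofReal_mul, inner_sub_left, inner_sub_right,
    sub_re, sub_re, h1, h2]

lemma re_inner_halfDiff (x y : H) : ⟪x, halfDiff V y⟫.re = ⟪halfDiff V x, y⟫.re := by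
  have h1 := re_inner_realProj V x y
  have h2 := re_inner_I_smul_realProj V x y
  rw [halfDiff_apply, halfDiff_apply, ← Complex.coe_smul, ← Complex.coe_smul, inner_smul_right,
    inner_smul_left, conj_ofReal, re_ofReal_mul, re_ofReal_mul, inner_add_left, inner_add_right,
    add_re, add_re, h1, h2]

lemma inner_halfSum (x y : H) : ⟪x, halfSum V y⟫ = ⟪halfSum V x, y⟫ := by
  refine inner_ext_of_re (re_inner_halfSum V x y) ?_
  rw [← map_smul]
  exact re_inner_halfSum V x (I • y)

lemma inner_halfDiff (x y : H) : ⟪x, halfDiff V y⟫ = ⟪y, halfDiff V x⟫ := by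
  have key : ∀ x y, ⟪x, halfDiff V y⟫.re = ⟪y, halfDiff V x⟫.re := fun x y => by
    rw [re_inner_halfDiff, ← inner_conj_symm, conj_re]
  refine inner_ext_of_re (key x y) ?_
  have := key x (-(I • y))
  rw [map_neg, halfDiff_smul_I, neg_neg] at this
  rw [this, inner_neg_left, inner_smul_left, inner_smul_right]
  simp

lemma isSelfAdjoint_halfSum : IsSelfAdjoint (halfSum V) :=
  isSelfAdjoint_iff_isSymmetric.2 fun x y => (inner_halfSum V x y).symm

lemma inner_halfDiff_self (x : H) :
    ⟪halfDiff V x, halfDiff V x⟫ = ⟪x, halfSum V x - halfSum V (halfSum V x)⟫ := by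
  rw [inner_halfDiff, halfDiff_halfDiff]

/-- From C = C² + D². It yields C ≥ 0, as the companion for 1 - C yields C ≤ 1. -/
lemma inner_halfSum_self (x : H) :
    ⟪x, halfSum V x⟫ = ((‖halfSum V x‖ ^ 2 + ‖halfDiff V x‖ ^ 2 : ℝ) : ℂ) := by
  have h := inner_halfDiff_self V x
  rw [inner_sub_right, inner_halfSum V x (halfSum V x), inner_self_eq_ofReal,
    inner_self_eq_ofReal] at h
  rw [ofReal_add, h]
  ring

lemma inner_sub_halfSum_self (x : H) :
    ⟪x, x - halfSum V x⟫ = ((‖x - halfSum V x‖ ^ 2 + ‖halfDiff V x‖ ^ 2 : ℝ) : ℂ) := by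
  have h := inner_halfDiff_self V x
  have h2 : ⟪x - halfSum V x, x - halfSum V x⟫ = ⟪x, x - halfSum V x⟫ -
      ⟪x, halfSum V x - halfSum V (halfSum V x)⟫ := by
    rw [inner_sub_left, ← inner_halfSum, map_sub]
  rw [← h, inner_self_eq_ofReal, inner_self_eq_ofReal] at h2
  rw [ofReal_add, h2]
  ring

lemma halfSum_nonneg : 0 ≤ halfSum V := by
  rw [nonneg_iff_isPositive, isPositive_iff_complex]
  intro x
  rw [← inner_halfSum, inner_halfSum_self]
  exact ⟨by rw [RCLike.re_to_complex, ofReal_re], by rw [RCLike.re_to_complex, ofReal_re]; positivity⟩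

lemma one_sub_halfSum_nonneg : 0 ≤ 1 - halfSum V := by
  rw [nonneg_iff_isPositive, isPositive_iff_complex]
  intro x
  have h : ⟪(1 - halfSum V) x, x⟫ = ⟪x, x - halfSum V x⟫ := by
    rw [FunLike.coe_sub, Pi.sub_apply, one_apply_eq_self, inner_sub_left, inner_sub_right, inner_halfSum]
  rw [h, inner_sub_halfSum_self]
  exact ⟨by rw [RCLike.re_to_complex, ofReal_re], by rw [RCLike.re_to_complex, ofReal_re]; positivity⟩

open scoped ComplexOrder in
lemma spectrum_halfSum_subset : spectrum ℂ (halfSum V) ⊆ unitSegment := by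
  intro z hz
  have h0 : 0 ≤ z := spectrum_nonneg_of_nonneg (halfSum_nonneg V) hz
  have h1 : 0 ≤ 1 - z := by
    refine spectrum_nonneg_of_nonneg (one_sub_halfSum_nonneg V) ?_
    have := spectrum.singleton_sub_eq (halfSum V) (1 : ℂ)
    rw [map_one] at this
    rw [← this]
    exact Set.sub_mem_sub rfl hz
  rw [Complex.nonneg_iff] at h0 h1
  simp only [sub_re, one_re] at h1
  exact ⟨z.re, ⟨h0.1, by linarith [h1.1]⟩, Complex.ext (by simp) (by simpa using h0.2)⟩

lemma isPosResolvent_halfSum : IsPosResolvent (halfSum V) where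
  isSelfAdjoint := isSelfAdjoint_halfSum V
  spectrum_subset := spectrum_halfSum_subset V
  injective := by
    -- Since ‖Dx‖² = ⟪x, C(1 - C)x⟫ = 0, the projections of x to V and iV both equal Cx, which lies
    -- in V ∩ iV = 0. So x is orthogonal to V + iV.
    refine injective_of_apply_eq_zero fun x hx => ?_
    have h1 : halfSum V x - halfSum V (halfSum V x) = 0 := by
      rw [← hx]; simp
    have h2 : halfDiff V x = 0 := by
      rw [← inner_self_eq_zero (𝕜 := ℂ), inner_halfDiff_self, h1, inner_zero_right]
    have h3 := halfSum_add_halfDiff V x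
    have h4 := halfSum_sub_halfDiff V x
    rw [h2, add_zero] at h3
    rw [h2, sub_zero] at h4
    have h5 : halfSum V x = 0 := by
      refine eq_zero_of_mem_of_I_smul_mem V (h3 ▸ realProj_mem V x) ?_
      rw [h4, smul_neg, smul_smul, I_mul_I, neg_one_smul, neg_neg]
      exact realProj_mem V _
    rw [h5] at h3 h4
    refine eq_zero_of_realProj V h3.symm ?_
    have := neg_eq_zero.1 h4.symm
    exact (smul_eq_zero.1 this).resolve_left I_ne_zero

end StdSub

end

/-! ### J, Δ^{is} and the algebra 𝒜_V in terms of C and D. -/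

noncomputable section

namespace StdSub

open Filter Topology Set Metric ContinuousLinearMap

variable {H : Type*} [NormedAddCommGroup H] [InnerProductSpace ℂ H] [CompleteSpace H]
  (V : StandardSubspace H)

/-! ### The polar decomposition -/

/-- S carries the calculus of C to that of 1 - C, which is rewritten in C by composing with c ↦ 1 -
c. S is arbitrary because both D and J are needed. -/
lemma intertwines_cfc {S : H →L⋆[ℂ] H} (hS : ∀ x, S (halfSum V x) = S x - halfSum V (S x))
    {f : ℂ → ℂ} (hf : ContinuousOn f unitSegment) (x : H) :
    S (cfc f (halfSum V) x) = cfc (fun c => star (f (1 - c))) (halfSum V) (S x) := by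
  have hC := isPosResolvent_halfSum V
  have hn := hC.isStarNormal
  have hsub : MapsTo (fun c : ℂ => 1 - c) (spectrum ℂ (halfSum V)) unitSegment :=
    fun c hc => one_sub_mem_unitSegment (hC.spectrum_subset hc)
  have h1 : (1 : H →L[ℂ] H) - halfSum V = cfc (fun c : ℂ => 1 - c) (halfSum V) := by
    rw [cfc_sub _ _ (halfSum V), cfc_id' ℂ (halfSum V), cfc_const_one ℂ (halfSum V)]
  have hsp : spectrum ℂ (1 - halfSum V) = (fun c : ℂ => 1 - c) '' spectrum ℂ (halfSum V) := by
    rw [h1, cfc_map_spectrum (fun c : ℂ => 1 - c) (halfSum V)]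
  have hsp' : spectrum ℂ (1 - halfSum V) ⊆ unitSegment := by
    rw [hsp]; exact hsub.image_subset
  have hf' : ContinuousOn (fun c => star (f c)) unitSegment := continuous_star.comp_continuousOn hf
  rw [antilinear_intertwines_cfc (N := 1 - halfSum V) hC.isSelfAdjoint
    ((IsSelfAdjoint.one _).sub hC.isSelfAdjoint) hS
    (hf.mono (union_subset hC.spectrum_subset hsp')), h1,
    ← cfc_comp' (fun c => star (f c)) (fun c : ℂ => 1 - c) (halfSum V) (hf'.mono hsub.image_subset)]

lemma halfDiff_sqrtOp (x : H) :
    halfDiff V (sqrtOp (halfSum V) x) = sqrtOp (halfSum V) (halfDiff V x) := by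
  rw [sqrtOp, intertwines_cfc V (halfDiff_halfSum V) continuous_sqrtFun.continuousOn]
  rw [(isPosResolvent_halfSum V).cfc_congr (f := fun c => star (sqrtFun (1 - c))) (g := sqrtFun)]
  intro c hc
  rw [sqrtFun_one_sub c hc]
  simp [sqrtFun]

lemma sqrtOp_sqrtOp (x : H) : sqrtOp (halfSum V) (sqrtOp (halfSum V) x) =
    halfSum V x - halfSum V (halfSum V x) := by
  have hC := isPosResolvent_halfSum V
  have h := DFunLike.congr_fun (hC.sqrtOp_mul_self.trans hC.regPow_zero) x
  rw [mul_apply_eq_comp] at h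
  rw [h]
  simp

lemma inner_halfDiff_halfDiff (x y : H) : ⟪halfDiff V x, halfDiff V y⟫ =
    ⟪sqrtOp (halfSum V) y, sqrtOp (halfSum V) x⟫ := by
  rw [inner_halfDiff, halfDiff_halfDiff, (isPosResolvent_halfSum V).inner_sqrtOp,
    ← sqrtOp_sqrtOp, (isPosResolvent_halfSum V).inner_sqrtOp,
    (isPosResolvent_halfSum V).inner_sqrtOp]

lemma norm_halfDiff (x : H) : ‖halfDiff V x‖ = ‖sqrtOp (halfSum V) x‖ := by
  have h := inner_halfDiff_halfDiff V x x
  rw [inner_self_eq_ofReal, inner_self_eq_ofReal, ofReal_inj] at h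
  exact (sq_eq_sq₀ (norm_nonneg _) (norm_nonneg _)).1 h

/-- The antilinear part of the polar decomposition of `halfDiff V`. -/
def polarConj : H →L⋆[ℂ] H :=
  LinearMap.extendOfNorm (halfDiff V).toLinearMap (sqrtOp (halfSum V)).toLinearMap

lemma denseRange_sqrtOp : DenseRange (sqrtOp (halfSum V)) :=
  (isPosResolvent_halfSum V).sqrtOp_denseRange

@[simp] lemma polarConj_sqrtOp (x : H) :
    polarConj V (sqrtOp (halfSum V) x) = halfDiff V x :=
  LinearMap.extendOfNorm_eq (f := (halfDiff V).toLinearMap)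
    (e := (sqrtOp (halfSum V)).toLinearMap) (denseRange_sqrtOp V)
    ⟨1, fun x => by rw [one_mul]; exact (norm_halfDiff V x).le⟩ x

lemma sqrtOp_polarConj (x : H) : sqrtOp (halfSum V) (polarConj V x) = halfDiff V x := by
  refine congrFun ((denseRange_sqrtOp V).equalizer ((sqrtOp (halfSum V)).continuous.comp
    (polarConj V).continuous) (halfDiff V).continuous ?_) x
  ext y
  simp [halfDiff_sqrtOp]

lemma polarConj_polarConj (x : H) : polarConj V (polarConj V x) = x := by
  refine (isPosResolvent_halfSum V).sqrtOp_injective ?_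
  refine (isPosResolvent_halfSum V).sqrtOp_injective ?_
  rw [sqrtOp_polarConj, ← halfDiff_sqrtOp, sqrtOp_polarConj, halfDiff_halfDiff, sqrtOp_sqrtOp]

lemma inner_polarConj_polarConj (x y : H) : ⟪polarConj V x, polarConj V y⟫ = ⟪y, x⟫ := by
  refine (denseRange_sqrtOp V).induction_on₂ (p := fun x y =>
    ⟪polarConj V x, polarConj V y⟫ = ⟪y, x⟫) ?_ ?_ x y
  · exact isClosed_eq (by fun_prop) (by fun_prop)
  · intro x y
    rw [polarConj_sqrtOp, polarConj_sqrtOp, inner_halfDiff_halfDiff]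

lemma inner_polarConj (x y : H) : ⟪x, polarConj V y⟫ = ⟪y, polarConj V x⟫ := by
  rw [← inner_polarConj_polarConj, polarConj_polarConj]

lemma norm_polarConj (x : H) : ‖polarConj V x‖ = ‖x‖ := by
  have h := inner_polarConj_polarConj V x x
  rw [inner_self_eq_ofReal, inner_self_eq_ofReal, ofReal_inj] at h
  exact (sq_eq_sq₀ (norm_nonneg _) (norm_nonneg _)).1 h

lemma sqrtOp_comm_halfSum (x : H) : sqrtOp (halfSum V) (halfSum V x) =
    halfSum V (sqrtOp (halfSum V) x) :=
  DFunLike.congr_fun (isPosResolvent_halfSum V).sqrtOp_commute.eq x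

lemma polarConj_halfSum (x : H) :
    polarConj V (halfSum V x) = polarConj V x - halfSum V (polarConj V x) := by
  refine (isPosResolvent_halfSum V).sqrtOp_injective ?_
  rw [map_sub, sqrtOp_comm_halfSum, sqrtOp_polarConj, sqrtOp_polarConj, halfDiff_halfSum]

lemma polarConj_regPow {w : ℂ} (hw : |w.re| < 1) (x : H) :
    polarConj V (regPow (halfSum V) w x) = regPow (halfSum V) (-star w) (polarConj V x) := by
  rw [regPow, intertwines_cfc V (polarConj_halfSum V) (continuousOn_powFun hw)]
  rw [(isPosResolvent_halfSum V).cfc_congr (f := fun c => star (powFun w (1 - c)))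
    (g := powFun (-star w))]
  · rfl
  · intro c hc
    rw [powFun_one_sub w c hc, conj_powFun _ c hc, star_neg]

/-! ### Identification of the modular objects -/

/-- For a = x + iy and b = x - iy, a + b = 2x is fixed by the projection C + D onto V, and a - b =
2iy by the projection C - D onto iV. The two equations are half the sum and half the difference of
these conditions. -/
lemma mem_tomitaGraph_iff (a b : H) : (a, b) ∈ tomitaGraph V ↔
    a - halfSum V a = halfDiff V b ∧ b - halfSum V b = halfDiff V a := by
  have h1 : (a, b) ∈ tomitaGraph V ↔
      a + b ∈ V.toClosedSubmodule ∧ I • (a - b) ∈ V.toClosedSubmodule := by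
    constructor
    · rintro ⟨x, hx, y, hy, rfl, rfl⟩
      constructor
      · convert SMulMemClass.smul_mem (2 : ℝ) hx using 1; module
      · convert SMulMemClass.smul_mem (-2 : ℝ) hy using 1
        simp only [← Complex.coe_smul]
        match_scalars <;> apply Complex.ext <;> norm_num
    · rintro ⟨hx, hy⟩
      refine ⟨_, SMulMemClass.smul_mem (1 / 2 : ℝ) hx, _, SMulMemClass.smul_mem (-1 / 2 : ℝ) hy,
        ?_, ?_⟩ <;>
      · simp only [← Complex.coe_smul]
        match_scalars <;> apply Complex.ext <;> simp <;> norm_num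
  rw [h1, ← realProj_eq_self_iff, ← realProj_eq_self_iff]
  have h2 : realProj V (I • (a - b)) = I • (a - b) ↔
      -(I • realProj V (I • (a - b))) = a - b := by
    constructor
    · intro h
      rw [h, smul_smul, I_mul_I, neg_one_smul, neg_neg]
    · intro h
      conv_rhs => rw [← h]
      rw [smul_neg, smul_smul, I_mul_I, neg_one_smul, neg_neg]
  rw [h2, ← halfSum_sub_halfDiff, ← halfSum_add_halfDiff]
  simp only [map_add, map_sub]
  constructor
  · rintro ⟨h3, h4⟩
    constructor
    · have : (2 : ℝ) • (a - halfSum V a) = (2 : ℝ) • halfDiff V b := by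
        linear_combination (norm := module) -h3 - h4
      exact smul_right_injective H (two_ne_zero' ℝ) this
    · have : (2 : ℝ) • (b - halfSum V b) = (2 : ℝ) • halfDiff V a := by
        linear_combination (norm := module) -h3 + h4
      exact smul_right_injective H (two_ne_zero' ℝ) this
  · rintro ⟨h3, h4⟩
    constructor
    · linear_combination (norm := module) -h3 - h4
    · linear_combination (norm := module) -h3 + h4

lemma halfSum_halfDiff_mem (x : H) : (halfSum V x, halfDiff V x) ∈ tomitaGraph V :=
  (mem_tomitaGraph_iff V _ _).2 ⟨(halfDiff_halfDiff V x).symm, (halfDiff_halfSum V x).symm⟩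

/-- This identifies C with (1 + Δ)⁻¹. The pair (Cx, Dx) lies on the graph of σ and solves the
adjoint equation. A second solution differs from it by some (u, v) on that graph with -‖u‖² = ‖v‖²,
so u = 0. -/
lemma mem_modularGraph_iff (x y : H) : (y, x - y) ∈ modularGraph V ↔ halfSum V x = y := by
  have key : ∀ a b, (a, b) ∈ tomitaGraph V → ⟪a, x - halfSum V x⟫ = ⟪halfDiff V x, b⟫ := by
    intro a b hab
    obtain ⟨h1, -⟩ := (mem_tomitaGraph_iff V a b).1 hab
    rw [inner_sub_right, inner_halfSum, ← inner_sub_left, h1, ← inner_conj_symm,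
      inner_halfDiff, inner_conj_symm]
  constructor
  · rintro ⟨y', hy', h⟩
    rw [tomita_graph] at hy' h
    simp only at hy' h
    have hmem : (y - halfSum V x, y' - halfDiff V x) ∈ tomitaGraph V :=
      sub_mem hy' (halfSum_halfDiff_mem V x)
    have h1 := h _ _ hmem
    have h2 := key _ _ hmem
    have h3 : ⟪y - halfSum V x, -(y - halfSum V x)⟫ = ⟪y' - halfDiff V x, y' - halfDiff V x⟫ := by
      rw [inner_sub_left y', ← h1, ← h2, ← inner_sub_right]
      congr 1; abel
    rw [inner_neg_right, inner_self_eq_ofReal, inner_self_eq_ofReal, ← ofReal_neg, ofReal_inj] at h3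
    have h4 : ‖y - halfSum V x‖ ^ 2 = 0 := by
      nlinarith [sq_nonneg ‖y - halfSum V x‖, sq_nonneg ‖y' - halfDiff V x‖]
    exact (sub_eq_zero.1 (norm_eq_zero.1 (pow_eq_zero_iff two_ne_zero |>.1 h4))).symm
  · rintro rfl
    refine ⟨halfDiff V x, ?_, fun a b hab => ?_⟩
    · rw [tomita_graph]; exact halfSum_halfDiff_mem V x
    · rw [tomita_graph] at hab
      exact key a b hab

lemma modularOperator_graph : (modularOperator V).graph = modularGraph V := by
  apply Submodule.toLinearPMap_graph_eq
  rintro ⟨a, b⟩ h h0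
  simp only at h0
  subst h0
  have h1 : halfSum V b = 0 := (mem_modularGraph_iff V b 0).1 (by simpa using h)
  have : (halfSum V * (1 - halfSum V)) b = 0 := by simp [h1]
  simpa using (isPosResolvent_halfSum V).injective (this.trans (map_zero _).symm)

lemma invOneAdd_modularOperator : invOneAdd (modularOperator V) = halfSum V := by
  have h : ∃ C : H →L[ℂ] H, ∀ ξ η, C ξ = η ↔ (η, ξ - η) ∈ (modularOperator V).graph :=
    ⟨halfSum V, fun ξ η => by rw [modularOperator_graph, mem_modularGraph_iff]⟩
  rw [invOneAdd, dif_pos h]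
  ext ξ
  refine (h.choose_spec ξ _).2 ?_
  rw [modularOperator_graph, mem_modularGraph_iff]

lemma mem_cpow_graph_iff (w : ℂ) (a b : H) :
    (a, b) ∈ (cpow (modularOperator V) w).graph ↔
      regPow (halfSum V) 0 b = regPow (halfSum V) w a := by
  have hC := isPosResolvent_halfSum V
  have key : ∀ a b, (a, b) ∈ cpowGraph (modularOperator V) w ↔
      regPow (halfSum V) 0 b = regPow (halfSum V) w a := by
    intro a b
    change (invOneAdd (modularOperator V) * (1 - invOneAdd (modularOperator V))) b =
      cfc (powFun w) (invOneAdd (modularOperator V)) a ↔ _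
    rw [invOneAdd_modularOperator, hC.regPow_zero]
    rfl
  rw [cpow, Submodule.toLinearPMap_graph_eq, key]
  rintro ⟨a, b⟩ h h0
  simp only at h0
  subst h0
  have := (key 0 b).1 h
  rw [map_zero] at this
  exact hC.regPow_zero_injective (this.trans (map_zero _).symm)

lemma regPow_half_apply (x : H) : regPow (halfSum V) (1 / 2) x =
    sqrtOp (halfSum V) (x - halfSum V x) := by
  rw [← (isPosResolvent_halfSum V).sqrtOp_mul_one_sub]
  simp

lemma regPow_zero_apply (x : H) : regPow (halfSum V) 0 x =
    sqrtOp (halfSum V) (sqrtOp (halfSum V) x) := by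
  rw [← (isPosResolvent_halfSum V).sqrtOp_mul_self]
  rfl

/-- The relation σ = JΔ^{1/2}, freed of domains. The first equation of `mem_tomitaGraph_iff`
suffices: cancelling a factor (C(1 - C))^{1/2} leaves (C(1 - C))^{1/2} ξ = CJη, and applying J gives
the second. -/
lemma mem_tomita_graph_iff_polar (ξ η : H) : (ξ, η) ∈ (tomita V).graph ↔
    regPow (halfSum V) 0 (polarConj V η) = regPow (halfSum V) (1 / 2) ξ := by
  have hC := isPosResolvent_halfSum V
  rw [tomita_graph, mem_tomitaGraph_iff, regPow_half_apply, regPow_zero_apply,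
    hC.sqrtOp_injective.eq_iff, sqrtOp_polarConj]
  refine ⟨fun h => h.1.symm, fun h => ⟨h.symm, ?_⟩⟩
  have h1 : sqrtOp (halfSum V) ξ = halfSum V (polarConj V η) := by
    refine hC.sqrtOp_injective ?_
    rw [sqrtOp_sqrtOp, ← map_sub, ← h, sqrtOp_comm_halfSum, sqrtOp_polarConj]
  rw [← polarConj_sqrtOp, h1, polarConj_halfSum, polarConj_polarConj]

lemma modularConj_eq : modularConj V = polarConj V := by
  have hC := isPosResolvent_halfSum V
  have hspec : ∀ ξ η, (ξ, η) ∈ (tomita V).graph ↔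
      ∃ ζ, (ξ, ζ) ∈ (cpow (modularOperator V) (1 / 2)).graph ∧ polarConj V ζ = η := by
    intro ξ η
    rw [mem_tomita_graph_iff_polar]
    constructor
    · intro h
      exact ⟨polarConj V η, (mem_cpow_graph_iff V _ _ _).2 h, polarConj_polarConj V η⟩
    · rintro ⟨ζ, h, rfl⟩
      rw [polarConj_polarConj]
      exact (mem_cpow_graph_iff V _ _ _).1 h
  have h : ∃ J : H →L⋆[ℂ] H, ∀ ξ η, (ξ, η) ∈ (tomita V).graph ↔
    ∃ ζ, (ξ, ζ) ∈ (cpow (modularOperator V) (1 / 2)).graph ∧ J ζ = η := ⟨polarConj V, hspec⟩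
  rw [modularConj, dif_pos h]
  -- The chosen J is determined by its defining property on the range of Δ^{1/2}, which contains
  -- this dense range.
  have hd : DenseRange (regPow (halfSum V) (1 / 2)) := hC.regPow_denseRange (by norm_num)
  ext x
  refine congrFun (hd.equalizer h.choose.continuous (polarConj V).continuous ?_) x
  ext y
  have hmem : regPow (halfSum V) 0 (regPow (halfSum V) (1 / 2) y) =
      regPow (halfSum V) (1 / 2) (regPow (halfSum V) 0 y) :=
    DFunLike.congr_fun (IsPosResolvent.regPow_commute 0 (1 / 2)).eq y
  have h1 : (regPow (halfSum V) 0 y, polarConj V (regPow (halfSum V) (1 / 2) y)) ∈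
      (tomita V).graph := by
    rw [mem_tomita_graph_iff_polar, polarConj_polarConj, hmem]
  obtain ⟨ζ, hζ, h2⟩ := (h.choose_spec _ _).1 h1
  rw [mem_cpow_graph_iff, ← hmem] at hζ
  have := hC.regPow_zero_injective hζ
  subst this
  exact h2

/-! ### The modular group -/

lemma exists_modularUnitary (s : ℝ) : ∃ W : H →L[ℂ] H, ∀ x,
    regPow (halfSum V) 0 (W x) = regPow (halfSum V) (I * s) x := by
  have hC := isPosResolvent_halfSum V
  have hd : DenseRange (regPow (halfSum V) 0) := hC.regPow_denseRange (by simp)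
  set W := LinearMap.extendOfNorm (regPow (halfSum V) (I * s)).toLinearMap
    (regPow (halfSum V) 0).toLinearMap with hW
  have h1 : ∀ x, W (regPow (halfSum V) 0 x) = regPow (halfSum V) (I * s) x := fun x =>
    LinearMap.extendOfNorm_eq (f := (regPow (halfSum V) (I * s)).toLinearMap)
      (e := (regPow (halfSum V) 0).toLinearMap) hd
      ⟨1, fun x => by rw [one_mul]; exact (hC.norm_regPow_I_mul s x).le⟩ x
  refine ⟨W, fun x => ?_⟩
  refine congrFun (hd.equalizer ((regPow (halfSum V) 0).continuous.comp W.continuous)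
    (regPow (halfSum V) (I * s)).continuous ?_) x
  ext y
  simp only [Function.comp_apply, h1]
  exact DFunLike.congr_fun (IsPosResolvent.regPow_commute 0 (I * s)).eq y

lemma regPow_zero_mul_modularUnitary (s : ℝ) :
    regPow (halfSum V) 0 * modularUnitary V s = regPow (halfSum V) (I * s) := by
  have h : ∃ W : H →L[ℂ] H, ∀ ξ, (ξ, W ξ) ∈ (cpow (modularOperator V) (I * s)).graph := by
    obtain ⟨W, hW⟩ := exists_modularUnitary V s
    exact ⟨W, fun ξ => (mem_cpow_graph_iff V _ _ _).2 (hW ξ)⟩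
  ext x
  rw [modularUnitary, toBounded, dif_pos h]
  exact (mem_cpow_graph_iff V _ _ _).1 (h.choose_spec x)

lemma modularUnitary_mul_regPow_zero (s : ℝ) :
    modularUnitary V s * regPow (halfSum V) 0 = regPow (halfSum V) (I * s) := by
  have hC := isPosResolvent_halfSum V
  refine eq_of_comp_injective hC.regPow_zero_injective ?_
  rw [← mul_assoc, regPow_zero_mul_modularUnitary, (IsPosResolvent.regPow_commute _ _).eq]

/-! ### Operators leaving `V` invariant -/

/-- The operator `J A J`. -/
def conjBy (A : H →L[ℂ] H) : H →L[ℂ] H := (polarConj V).comp (A.comp (polarConj V))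

@[simp] lemma conjBy_apply (A : H →L[ℂ] H) (x : H) :
    conjBy V A x = polarConj V (A (polarConj V x)) := rfl

variable {V}

omit [CompleteSpace H] in
lemma map_mem_tomita_graph {A : H →L[ℂ] H} (hA : A ∈ realOperators V) {ξ η : H}
    (h : (ξ, η) ∈ (tomita V).graph) : (A ξ, A η) ∈ (tomita V).graph := by
  rw [tomita_graph] at h ⊢
  obtain ⟨x, hx, y, hy, h1, h2⟩ := h
  simp only at h1 h2
  exact ⟨A x, hA x hx, A y, hA y hy, by simp [h1], by simp [h2]⟩

/-- A commutes with σ = JΔ^{1/2}, so (JAJ) Δ^{1/2} ξ = Δ^{1/2} A ξ, taken here at ξ = R_0 x. The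
construction of the continuation uses the invariance of V only through this identity. -/
lemma regPow_half_mul_mul_regPow_zero {A : H →L[ℂ] H} (hA : A ∈ realOperators V) :
    regPow (halfSum V) 0 * conjBy V A * regPow (halfSum V) (1 / 2) =
      regPow (halfSum V) (1 / 2) * A * regPow (halfSum V) 0 := by
  ext x
  have h1 : (regPow (halfSum V) 0 x, polarConj V (regPow (halfSum V) (1 / 2) x)) ∈
      (tomita V).graph := by
    rw [mem_tomita_graph_iff_polar, polarConj_polarConj]
    exact DFunLike.congr_fun (IsPosResolvent.regPow_commute 0 (1 / 2)).eq x
  exact (mem_tomita_graph_iff_polar V _ _).1 (map_mem_tomita_graph hA h1)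

end StdSub

end

/-! ### Three lines estimates and existence and uniqueness of the continuation. -/

noncomputable section

namespace StdSub

open Filter Topology Set Metric ContinuousLinearMap

section Coefficients

variable {H : Type*} [NormedAddCommGroup H] [InnerProductSpace ℂ H]

/-! ### Bounds by matrix coefficients on a dense range -/

lemma norm_le_of_dense_inner {T : H →L[ℂ] H} (hT : DenseRange T) {y : H} {K : ℝ} (hK : 0 ≤ K)
    (h : ∀ x, ‖⟪T x, y⟫‖ ≤ K * ‖T x‖) : ‖y‖ ≤ K := by
  have h1 : ‖⟪y, y⟫‖ ≤ K * ‖y‖ :=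
    hT.induction_on (p := fun x => ‖⟪x, y⟫‖ ≤ K * ‖x‖) y
      (isClosed_le (by fun_prop) (by fun_prop)) h
  rw [inner_self_eq_ofReal, norm_real, Real.norm_of_nonneg (sq_nonneg _), sq] at h1
  rcases (norm_nonneg y).eq_or_lt with h2 | h2
  · rwa [← h2]
  · exact le_of_mul_le_mul_right h1 h2

lemma opNorm_le_of_dense_inner {T X : H →L[ℂ] H} (hT : DenseRange T) {K : ℝ} (hK : 0 ≤ K)
    (h : ∀ x y, ‖⟪T x, X (T y)⟫‖ ≤ K * (‖T x‖ * ‖T y‖)) : ‖X‖ ≤ K := by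
  refine X.opNorm_le_bound hK fun x => ?_
  refine hT.induction_on (p := fun x => ‖X x‖ ≤ K * ‖x‖) x
    (isClosed_le (by fun_prop) (by fun_prop)) fun y => ?_
  refine norm_le_of_dense_inner hT (by positivity) fun x => (h x y).trans_eq (by ring)

/-- An operator `S` with `|⟪x, S y⟫| ≤ M ‖T x‖ ‖T y‖` factors as `S = T X T` with `‖X‖ ≤ M`. -/
lemma exists_mul_mul_eq [CompleteSpace H] {S T : H →L[ℂ] H} (hT : DenseRange T)
    (hTi : Function.Injective T) (hTs : ∀ x y, ⟪x, T y⟫ = ⟪T x, y⟫) {M : ℝ} (hM : 0 ≤ M)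
    (h : ∀ x y, ‖⟪x, S y⟫‖ ≤ M * (‖T x‖ * ‖T y‖)) : ∃ X : H →L[ℂ] H, ‖X‖ ≤ M ∧ T * X * T = S := by
  -- The functional Tx ↦ ⟪Sy, x⟫ is bounded by M‖Ty‖, and its Riesz vector u satisfies Tu = Sy. Then
  -- X is the extension of Ty ↦ u.
  have h1 : ∀ y, ∃ u, T u = S y ∧ ‖u‖ ≤ M * ‖T y‖ := by
    intro y
    have hb : ∀ x, ‖(innerSL ℂ (S y)).toLinearMap x‖ ≤ (M * ‖T y‖) * ‖T.toLinearMap x‖ := by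
      intro x
      simp only [coe_coe, innerSL_apply_apply]
      rw [norm_inner_symm]
      exact (h x y).trans_eq (by ring)
    set l := LinearMap.extendOfNorm (innerSL ℂ (S y)).toLinearMap T.toLinearMap with hl
    have hl1 : ∀ x, l (T x) = ⟪S y, x⟫ := fun x =>
      LinearMap.extendOfNorm_eq (f := (innerSL ℂ (S y)).toLinearMap) (e := T.toLinearMap) hT
        ⟨_, hb⟩ x
    have hl2 : ‖l‖ ≤ M * ‖T y‖ :=
      LinearMap.opNorm_extendOfNorm_le (f := (innerSL ℂ (S y)).toLinearMap) (e := T.toLinearMap)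
        hT (by positivity) hb
    refine ⟨(InnerProductSpace.toDual ℂ H).symm l, ?_, by simpa using hl2⟩
    refine ext_inner_right ℂ fun x => ?_
    rw [← hTs, InnerProductSpace.toDual_symm_apply, hl1]
  choose Y hY1 hY2 using h1
  let L : H →ₗ[ℂ] H :=
    { toFun := Y
      map_add' := fun x y => hTi (by rw [map_add, hY1, hY1, hY1, map_add])
      map_smul' := fun c x => hTi (by rw [RingHom.id_apply, map_smul, hY1, hY1, map_smul]) }
  have hX1 : ∀ x, LinearMap.extendOfNorm L T.toLinearMap (T x) = Y x := fun x =>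
    LinearMap.extendOfNorm_eq (f := L) (e := T.toLinearMap) hT ⟨M, hY2⟩ x
  refine ⟨LinearMap.extendOfNorm L T.toLinearMap,
    LinearMap.opNorm_extendOfNorm_le (f := L) (e := T.toLinearMap) hT hM hY2, ?_⟩
  ext x
  rw [mul_apply_eq_comp, mul_apply_eq_comp, hX1, hY1]

end Coefficients

/-! ### Three lines estimates -/

lemma abs_lt_one_of_mem {r : ℝ} (hr : r ∈ Icc (0 : ℝ) (1 / 2)) : |r| < 1 :=
  abs_lt.2 ⟨by linarith [hr.1], by linarith [hr.2]⟩

/-- M only supplies the growth hypothesis of Phragmén–Lindelöf and drops out of the bound. -/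
lemma norm_le_of_half_strip {f : ℂ → ℂ} {K M : ℝ} (hf : DifferentiableOn ℂ f {w | |w.re| < 1})
    (hM : ∀ w : ℂ, |w.re| < 1 → ‖f w‖ ≤ M) (h0 : ∀ s : ℝ, ‖f (I * s)‖ ≤ K)
    (h1 : ∀ s : ℝ, ‖f (1 / 2 + I * s)‖ ≤ K) {w : ℂ} (hw : w.re ∈ Icc (0 : ℝ) (1 / 2)) :
    ‖f w‖ ≤ K := by
  refine norm_le_of_vertical_strip (a := 0) (b := 1 / 2) (M := M) (by norm_num) ?_ ?_ ?_ ?_ hw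
  · refine DifferentiableOn.diffContOnCl (hf.mono ?_)
    rw [closure_preimage_re, closure_Ioo (by norm_num)]
    exact fun z hz => abs_lt_one_of_mem hz
  · rintro z ⟨h1, h2⟩
    exact hM z (abs_lt.2 ⟨by linarith, by linarith⟩)
  · intro z hz
    rw [show z = I * (z.im : ℝ) by apply Complex.ext <;> simp [hz]]
    exact h0 _
  · intro z hz
    rw [show z = 1 / 2 + I * (z.im : ℝ) by apply Complex.ext <;> simp [hz]]
    exact h1 _

variable {H : Type*} [NormedAddCommGroup H] [InnerProductSpace ℂ H] [CompleteSpace H]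

namespace IsPosResolvent

variable {C : H →L[ℂ] H} (hC : IsPosResolvent C)
include hC

lemma differentiableOn_regPow_neg :
    DifferentiableOn ℂ (fun w => regPow C (-w)) {w : ℂ | |w.re| < 1} :=
  hC.differentiableOn_regPow.comp differentiable_neg.differentiableOn fun w hw => by
    simpa using hw

lemma norm_star_I_mul (s : ℝ) (x : H) : ‖regPow C (star (I * s)) x‖ = ‖regPow C 0 x‖ := by
  rw [show star (I * s : ℂ) = I * ((-s : ℝ) : ℂ) by simp, hC.norm_regPow_I_mul]

lemma norm_neg_I_mul (s : ℝ) (x : H) : ‖regPow C (-(I * s)) x‖ = ‖regPow C 0 x‖ := by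
  rw [show -(I * s : ℂ) = I * ((-s : ℝ) : ℂ) by simp, hC.norm_regPow_I_mul]

lemma regPow_half_add (s : ℝ) {a b : H} (h : regPow C 0 b = regPow C (1 / 2) a) :
    regPow C (1 / 2 + I * s) a = regPow C (I * s) b := by
  refine hC.regPow_zero_injective ?_
  have h1 : regPow C 0 * regPow C (1 / 2 + I * s) = regPow C (I * s) * regPow C (1 / 2) :=
    hC.regPow_mul_regPow (by simp) (by norm_num) (by simp) (by norm_num) (by ring)
  have h2 := DFunLike.congr_fun h1 a
  have h3 := DFunLike.congr_fun (regPow_commute (C := C) 0 (I * s)).eq b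
  simp only [mul_apply_eq_comp] at h2 h3
  rw [h2, ← h, h3]

/-- If `b = T ^ (1/2) a` and `y = T ^ w a` with `0 ≤ Re w ≤ 1/2`, then `‖y‖ ≤ max ‖a‖ ‖b‖`. -/
lemma norm_le_of_regPow_eq {a b y : H} {w : ℂ} {K : ℝ} (hw : w.re ∈ Icc (0 : ℝ) (1 / 2))
    (hb : regPow C 0 b = regPow C (1 / 2) a) (hy : regPow C 0 y = regPow C w a)
    (ha1 : ‖a‖ ≤ K) (hb1 : ‖b‖ ≤ K) : ‖y‖ ≤ K := by
  have hK : 0 ≤ K := (norm_nonneg a).trans ha1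
  -- Against R_0 x, the vector y has the coefficient ⟪x, R_w a⟫, holomorphic in w. On the two edges,
  -- unitarity of Δ^{is} bounds it by ‖R_0 x‖ times ‖a‖ and ‖b‖ respectively.
  refine norm_le_of_dense_inner (hC.regPow_denseRange (w := 0) (by simp)) hK fun x => ?_
  rw [← hC.inner_regPow_zero, hy]
  refine norm_le_of_half_strip (f := fun w => ⟪x, regPow C w a⟫) (M := ‖x‖ * ‖a‖) ?_ ?_ ?_ ?_ hw
  · have : (fun w => ⟪x, regPow C w a⟫) = fun w => innerSL ℂ x (regPow C w a) := rfl
    rw [this]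
    exact (innerSL ℂ x).differentiable.comp_differentiableOn
      (hC.differentiableOn_regPow.clm_apply (differentiableOn_const a))
  · intro w hw
    refine (norm_inner_le_norm _ _).trans ?_
    gcongr
    exact (le_opNorm _ _).trans (mul_le_of_le_one_left (norm_nonneg _) (hC.norm_regPow_le hw.le))
  · intro s
    rw [hC.inner_regPow]
    refine (norm_inner_le_norm _ _).trans ?_
    rw [hC.norm_star_I_mul, mul_comm]
    gcongr
  · intro s
    rw [hC.regPow_half_add s hb, hC.inner_regPow]
    refine (norm_inner_le_norm _ _).trans ?_
    rw [hC.norm_star_I_mul, mul_comm]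
    gcongr

end IsPosResolvent

variable (V : StandardSubspace H)

/-! ### The analytic continuation of the orbit maps -/

/-- The operator `C (1 - C) Δ ^ w A Δ ^ (-w) C (1 - C)`, where `C = (1 + Δ)⁻¹`. -/
def regOrbit (A : H →L[ℂ] H) (w : ℂ) : H →L[ℂ] H :=
  regPow (halfSum V) w * A * regPow (halfSum V) (-w)

variable {V}

lemma regOrbit_half {A : H →L[ℂ] H} (hA : A ∈ realOperators V) :
    regOrbit V A (1 / 2) = regPow (halfSum V) 0 * conjBy V A * regPow (halfSum V) 0 := by
  have hC := isPosResolvent_halfSum V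
  refine eq_of_comp_denseRange (hC.regPow_denseRange (w := 0) (by simp)) ?_
  have h1 : regPow (halfSum V) 0 * regPow (halfSum V) 0 =
      regPow (halfSum V) (1 / 2) * regPow (halfSum V) (-(1 / 2)) :=
    hC.regPow_mul_regPow (by simp) (by simp) (by norm_num) (by norm_num) (by ring)
  rw [regOrbit, mul_assoc _ (regPow _ 0) (regPow _ 0), h1, ← mul_assoc,
    regPow_half_mul_mul_regPow_zero hA, mul_assoc _ (regPow _ 0),
    (IsPosResolvent.regPow_commute 0 _).eq, mul_assoc, mul_assoc]

/-- On the edge Re w = 1/2 the orbit of A is the unitary orbit of JAJ. The extra factors R_0 leave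
room to split the exponents 1/2 + is and -(1/2 + is). -/
lemma regOrbit_half_add {A : H →L[ℂ] H} (hA : A ∈ realOperators V) (s : ℝ) :
    regOrbit V A (1 / 2 + I * s) = regOrbit V (conjBy V A) (I * s) := by
  have hC := isPosResolvent_halfSum V
  refine eq_of_comp_denseRange (hC.regPow_denseRange (w := 0) (by simp)) ?_
  refine eq_of_comp_injective hC.regPow_zero_injective ?_
  have h1 : regPow (halfSum V) 0 * regPow (halfSum V) (1 / 2 + I * s) =
      regPow (halfSum V) (I * s) * regPow (halfSum V) (1 / 2) :=
    hC.regPow_mul_regPow (by simp) (by norm_num) (by simp) (by norm_num) (by ring)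
  have h2 : regPow (halfSum V) (-(1 / 2 + I * s)) * regPow (halfSum V) 0 =
      regPow (halfSum V) (-(1 / 2)) * regPow (halfSum V) (-(I * s)) :=
    hC.regPow_mul_regPow (by norm_num) (by simp) (by norm_num) (by simp) (by ring)
  have h3 := regOrbit_half hA
  calc regPow (halfSum V) 0 * (regOrbit V A (1 / 2 + I * s) * regPow (halfSum V) 0)
      = (regPow (halfSum V) 0 * regPow (halfSum V) (1 / 2 + I * s)) * A *
        (regPow (halfSum V) (-(1 / 2 + I * s)) * regPow (halfSum V) 0) := by
        simp only [regOrbit, mul_assoc]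
    _ = regPow (halfSum V) (I * s) * regOrbit V A (1 / 2) * regPow (halfSum V) (-(I * s)) := by
        rw [h1, h2]; simp only [regOrbit, mul_assoc]
    _ = (regPow (halfSum V) (I * s) * regPow (halfSum V) 0) * conjBy V A *
        (regPow (halfSum V) 0 * regPow (halfSum V) (-(I * s))) := by
        rw [h3]; simp only [mul_assoc]
    _ = _ := by
        rw [(IsPosResolvent.regPow_commute (I * s) 0).eq,
          (IsPosResolvent.regPow_commute 0 (-(I * s))).eq]
        simp only [regOrbit, mul_assoc]

lemma norm_inner_regOrbit_I_mul_le (A : H →L[ℂ] H) {K : ℝ} (hA : ∀ x, ‖A x‖ ≤ K * ‖x‖)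
    (x y : H) (s : ℝ) : ‖⟪x, regOrbit V A (I * s) y⟫‖ ≤
      K * (‖regPow (halfSum V) 0 x‖ * ‖regPow (halfSum V) 0 y‖) := by
  have hC := isPosResolvent_halfSum V
  rw [regOrbit, mul_apply_eq_comp, mul_apply_eq_comp, hC.inner_regPow]
  refine (norm_inner_le_norm _ _).trans ?_
  have h1 := hA (regPow (halfSum V) (-(I * s)) y)
  rw [hC.norm_neg_I_mul] at h1
  rw [hC.norm_star_I_mul]
  calc _ ≤ ‖regPow (halfSum V) 0 x‖ * (K * ‖regPow (halfSum V) 0 y‖) := by gcongr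
    _ = _ := by ring

lemma norm_conjBy_apply_le (A : H →L[ℂ] H) (x : H) : ‖conjBy V A x‖ ≤ ‖A‖ * ‖x‖ := by
  rw [conjBy_apply, norm_polarConj, ← norm_polarConj V x]
  exact le_opNorm _ _

lemma differentiableOn_regOrbit (A : H →L[ℂ] H) :
    DifferentiableOn ℂ (regOrbit V A) {w | |w.re| < 1} := by
  have hC := isPosResolvent_halfSum V
  exact (hC.differentiableOn_regPow.mul_const A).mul hC.differentiableOn_regPow_neg

lemma differentiableOn_inner_regOrbit (A : H →L[ℂ] H) (x y : H) :
    DifferentiableOn ℂ (fun w => ⟪x, regOrbit V A w y⟫) {w | |w.re| < 1} := by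
  have : (fun w => ⟪x, regOrbit V A w y⟫) = fun w => innerSL ℂ x (regOrbit V A w y) := rfl
  rw [this]
  exact (innerSL ℂ x).differentiable.comp_differentiableOn
    ((differentiableOn_regOrbit A).clm_apply (differentiableOn_const y))

lemma norm_regOrbit_le (A : H →L[ℂ] H) {w : ℂ} (hw : |w.re| < 1) : ‖regOrbit V A w‖ ≤ ‖A‖ := by
  have hC := isPosResolvent_halfSum V
  have h1 := hC.norm_regPow_le hw.le
  have h2 := hC.norm_regPow_le (w := -w) (by simpa using hw.le)
  calc ‖regOrbit V A w‖ ≤ ‖regPow (halfSum V) w‖ * ‖A‖ * ‖regPow (halfSum V) (-w)‖ :=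
        (norm_mul_le _ _).trans (mul_le_mul_of_nonneg_right (norm_mul_le _ _) (norm_nonneg _))
    _ ≤ 1 * ‖A‖ * 1 := by gcongr
    _ = ‖A‖ := by ring

/-- Both edges are unitary orbits, of A and of JAJ. Having ‖R_0 x‖ and ‖R_0 y‖ on the right, and not
‖x‖ and ‖y‖, is what allows R_0 to be divided out. -/
lemma norm_inner_regOrbit_le {A : H →L[ℂ] H} (hA : A ∈ realOperators V) {w : ℂ}
    (hw : w.re ∈ Icc (0 : ℝ) (1 / 2)) (x y : H) : ‖⟪x, regOrbit V A w y⟫‖ ≤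
      ‖A‖ * (‖regPow (halfSum V) 0 x‖ * ‖regPow (halfSum V) 0 y‖) := by
  refine norm_le_of_half_strip (f := fun w => ⟪x, regOrbit V A w y⟫) (M := ‖x‖ * (‖A‖ * ‖y‖))
    (differentiableOn_inner_regOrbit A x y) ?_ ?_ ?_ hw
  · intro w hw
    refine (norm_inner_le_norm _ _).trans ?_
    gcongr
    exact (le_opNorm _ _).trans (mul_le_mul_of_nonneg_right (norm_regOrbit_le A hw)
      (norm_nonneg _))
  · exact norm_inner_regOrbit_I_mul_le A (le_opNorm A) x y
  · intro s
    rw [regOrbit_half_add hA]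
    exact norm_inner_regOrbit_I_mul_le _ (norm_conjBy_apply_le A) x y s

lemma exists_continuation {A : H →L[ℂ] H} (hA : A ∈ realOperators V) {w : ℂ}
    (hw : w.re ∈ Icc (0 : ℝ) (1 / 2)) : ∃ X : H →L[ℂ] H, ‖X‖ ≤ ‖A‖ ∧
      regPow (halfSum V) 0 * X * regPow (halfSum V) 0 = regOrbit V A w := by
  have hC := isPosResolvent_halfSum V
  exact exists_mul_mul_eq (hC.regPow_denseRange (by simp)) hC.regPow_zero_injective
    hC.inner_regPow_zero (norm_nonneg _) (norm_inner_regOrbit_le hA hw)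

lemma regPow_zero_mul_mul_injective {X Y : H →L[ℂ] H}
    (h : regPow (halfSum V) 0 * X * regPow (halfSum V) 0 =
      regPow (halfSum V) 0 * Y * regPow (halfSum V) 0) : X = Y := by
  have hC := isPosResolvent_halfSum V
  exact eq_of_comp_injective hC.regPow_zero_injective
    (eq_of_comp_denseRange (hC.regPow_denseRange (by simp)) h)

/-- The exponent `-i z / 2π`. -/
def stripExp (z : ℂ) : ℂ := -(I * z) / (2 * Real.pi)

lemma re_stripExp (z : ℂ) : (stripExp z).re = z.im / (2 * Real.pi) := by
  rw [stripExp, show (2 * (Real.pi : ℂ)) = ((2 * Real.pi : ℝ) : ℂ) by push_cast; rfl, div_ofReal_re]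
  simp

lemma stripExp_mem {z : ℂ} (hz : z ∈ closedStrip) : (stripExp z).re ∈ Icc (0 : ℝ) (1 / 2) := by
  rw [re_stripExp]
  have := Real.pi_pos
  refine ⟨div_nonneg hz.1 (by positivity), ?_⟩
  rw [div_le_div_iff₀ (by positivity) (by positivity)]
  linarith [hz.2]

lemma abs_stripExp {z : ℂ} (hz : z ∈ closedStrip) : |(stripExp z).re| < 1 :=
  abs_lt_one_of_mem (stripExp_mem hz)

lemma differentiable_stripExp : Differentiable ℂ stripExp := by
  unfold stripExp; fun_prop

open scoped Classical in
/-- The analytically continued orbit map, given by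
`C (1 - C) α^A(z) C (1 - C) = C (1 - C) Δ ^ (-iz/2π) A Δ ^ (iz/2π) C (1 - C)`. -/
def stripOrbit (V : StandardSubspace H) (A : H →L[ℂ] H) (z : ℂ) : H →L[ℂ] H :=
  if h : ∃ X : H →L[ℂ] H, ‖X‖ ≤ ‖A‖ ∧
    regPow (halfSum V) 0 * X * regPow (halfSum V) 0 = regOrbit V A (stripExp z)
  then h.choose else 0

section

variable {A : H →L[ℂ] H} (hA : A ∈ realOperators V)
include hA

lemma stripOrbit_spec {z : ℂ} (hz : z ∈ closedStrip) : ‖stripOrbit V A z‖ ≤ ‖A‖ ∧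
    regPow (halfSum V) 0 * stripOrbit V A z * regPow (halfSum V) 0 =
      regOrbit V A (stripExp z) := by
  have h := exists_continuation hA (stripExp_mem hz)
  rw [stripOrbit, dif_pos h]
  exact h.choose_spec

lemma stripOrbit_real (t : ℝ) : stripOrbit V A t =
    modularUnitary V (-t / (2 * Real.pi)) * A * modularUnitary V (t / (2 * Real.pi)) := by
  have hz : (t : ℂ) ∈ closedStrip := ⟨by simp, by simpa using Real.pi_pos.le⟩
  refine regPow_zero_mul_mul_injective (V := V) ?_
  rw [(stripOrbit_spec hA hz).2, mul_assoc (modularUnitary V _), ← mul_assoc (regPow _ 0),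
    regPow_zero_mul_modularUnitary, mul_assoc, mul_assoc, modularUnitary_mul_regPow_zero,
    regOrbit, mul_assoc]
  congr 3
  · rw [stripExp]; push_cast; ring
  · rw [stripExp]; push_cast; ring

lemma inner_stripOrbit {z : ℂ} (hz : z ∈ closedStrip) (x y : H) :
    ⟪regPow (halfSum V) 0 x, stripOrbit V A z (regPow (halfSum V) 0 y)⟫ =
      ⟪x, regOrbit V A (stripExp z) y⟫ := by
  rw [← (stripOrbit_spec hA hz).2, ← (isPosResolvent_halfSum V).inner_regPow_zero]
  rfl

/-- The coefficients between R_0 x and R_0 y are holomorphic and bounded by ‖A‖ ‖R_0 x‖ ‖R_0 y‖.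
Their slope estimates are therefore uniform and control the operator norm. -/
lemma differentiableOn_stripOrbit : DifferentiableOn ℂ (stripOrbit V A) openStrip := by
  have hC := isPosResolvent_halfSum V
  intro c hc
  obtain ⟨R, hR, hball⟩ := Metric.isOpen_iff.1 isOpen_openStrip c hc
  have hball' : ball c R ⊆ closedStrip := hball.trans openStrip_subset_closedStrip
  refine (differentiableAt_of_norm_slope_sub_slope_le (K := 4 * ‖A‖ / R ^ 2) hR
    fun z hz z' hz' hzc hzc' => ?_).differentiableWithinAt
  refine opNorm_le_of_dense_inner (hC.regPow_denseRange (w := 0) (by simp)) (by positivity)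
    fun x y => ?_
  set f : ℂ → ℂ := fun z =>
    ⟪regPow (halfSum V) 0 x, stripOrbit V A z (regPow (halfSum V) 0 y)⟫ with hf
  have hs : ∀ z, ⟪regPow (halfSum V) 0 x, (slope (stripOrbit V A) c z) (regPow (halfSum V) 0 y)⟫ =
      slope f c z := by
    intro z
    simp only [slope_def_module, hf, FunLike.coe_smul, FunLike.coe_sub, Pi.smul_apply,
      Pi.sub_apply, inner_smul_right, inner_sub_right, smul_eq_mul]
  have hd : DifferentiableOn ℂ f (ball c R) := by
    have h1 : DifferentiableOn ℂ (fun z => ⟪x, regOrbit V A (stripExp z) y⟫) (ball c R) :=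
      (differentiableOn_inner_regOrbit A x y).comp differentiable_stripExp.differentiableOn
        fun z hz => abs_stripExp (hball' hz)
    exact h1.congr fun z hz => inner_stripOrbit hA (hball' hz) x y
  have hb : ∀ z ∈ ball c R, ‖f z‖ ≤
      ‖A‖ * (‖regPow (halfSum V) 0 x‖ * ‖regPow (halfSum V) 0 y‖) := by
    intro z hz
    rw [hf]
    simp only
    rw [inner_stripOrbit hA (hball' hz)]
    exact norm_inner_regOrbit_le hA (stripExp_mem (hball' hz)) x y
  rw [FunLike.coe_sub, Pi.sub_apply, inner_sub_right, hs, hs]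
  exact (norm_slope_sub_slope_le hd hb hz hz' hzc hzc').trans_eq (by ring)

end

/-! #### Strong continuity -/

variable (V) in
/-- The vector `A Δ ^ (-w) C (1 - C) x`. -/
def lowerVec (A : H →L[ℂ] H) (x : H) (w : ℂ) : H := A (regPow (halfSum V) (-w) x)

variable (V) in
/-- The vector `J A J Δ ^ (1/2 - w) C (1 - C) x`. -/
def upperVec (A : H →L[ℂ] H) (x : H) (w : ℂ) : H :=
  conjBy V A (regPow (halfSum V) (1 / 2 - w) x)

/-- The upper vector is Δ^{1/2} applied to the lower one, while α^A(z) R_0 x is Δ^w applied to it.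
This is the setting of `norm_le_of_regPow_eq`. -/
lemma regPow_upperVec {A : H →L[ℂ] H} (hA : A ∈ realOperators V) (x : H) {w : ℂ}
    (hw : w.re ∈ Icc (0 : ℝ) (1 / 2)) :
    regPow (halfSum V) 0 (upperVec V A x w) = regPow (halfSum V) (1 / 2) (lowerVec V A x w) := by
  have hC := isPosResolvent_halfSum V
  have hw2 : |(1 / 2 - w).re| < 1 := by
    simp only [sub_re]
    norm_num
    exact abs_lt.2 ⟨by linarith [hw.2], by linarith [hw.1]⟩
  have hw3 : |(-w).re| < 1 := by simpa using abs_lt_one_of_mem hw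
  have h1 : regPow (halfSum V) (1 / 2 - w) * regPow (halfSum V) 0 =
      regPow (halfSum V) (1 / 2) * regPow (halfSum V) (-w) :=
    hC.regPow_mul_regPow hw2 (by simp) (by norm_num) hw3 (by ring)
  have h2 : regPow (halfSum V) 0 * conjBy V A * regPow (halfSum V) (1 / 2 - w) =
      regPow (halfSum V) (1 / 2) * A * regPow (halfSum V) (-w) := by
    refine eq_of_comp_denseRange (hC.regPow_denseRange (w := 0) (by simp)) ?_
    rw [mul_assoc _ (regPow _ (1 / 2 - w)), h1, ← mul_assoc, regPow_half_mul_mul_regPow_zero hA,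
      mul_assoc, mul_assoc, mul_assoc, mul_assoc, (IsPosResolvent.regPow_commute 0 (-w)).eq]
  exact DFunLike.congr_fun h2 x

lemma regPow_stripOrbit {A : H →L[ℂ] H} (hA : A ∈ realOperators V) (x : H) {z : ℂ}
    (hz : z ∈ closedStrip) :
    regPow (halfSum V) 0 (stripOrbit V A z (regPow (halfSum V) 0 x)) =
      regPow (halfSum V) (stripExp z) (lowerVec V A x (stripExp z)) :=
  DFunLike.congr_fun (stripOrbit_spec hA hz).2 x

lemma norm_stripOrbit_apply_le {A : H →L[ℂ] H} (hA : A ∈ realOperators V) (x : H) {z : ℂ}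
    (hz : z ∈ closedStrip) {K : ℝ} (h1 : ‖lowerVec V A x (stripExp z)‖ ≤ K)
    (h2 : ‖upperVec V A x (stripExp z)‖ ≤ K) :
    ‖stripOrbit V A z (regPow (halfSum V) 0 x)‖ ≤ K :=
  (isPosResolvent_halfSum V).norm_le_of_regPow_eq (stripExp_mem hz)
    (regPow_upperVec hA x (stripExp_mem hz)) (regPow_stripOrbit hA x hz) h1 h2

lemma continuousOn_lowerVec (A : H →L[ℂ] H) (x : H) :
    ContinuousOn (fun z => lowerVec V A x (stripExp z)) closedStrip := by
  have h := (isPosResolvent_halfSum V).differentiableOn_regPow.continuousOn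
  have h1 : ContinuousOn (fun z => regPow (halfSum V) (-stripExp z)) closedStrip :=
    h.comp differentiable_stripExp.continuous.neg.continuousOn fun z hz => by
      simpa using abs_stripExp hz
  exact A.continuous.comp_continuousOn (h1.clm_apply continuousOn_const)

lemma continuousOn_upperVec (A : H →L[ℂ] H) (x : H) :
    ContinuousOn (fun z => upperVec V A x (stripExp z)) closedStrip := by
  have h := (isPosResolvent_halfSum V).differentiableOn_regPow.continuousOn
  have h1 : ContinuousOn (fun z => regPow (halfSum V) (1 / 2 - stripExp z)) closedStrip :=
    h.comp (continuous_const.sub differentiable_stripExp.continuous).continuousOn fun z hz => by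
      have := stripExp_mem hz
      simp only [mem_ofPred_eq, sub_re]
      norm_num
      exact abs_lt.2 ⟨by linarith [this.2], by linarith [this.1]⟩
  exact (conjBy V A).continuous.comp_continuousOn (h1.clm_apply continuousOn_const)

/-- With a, b the lower and upper vectors, replace Δ^w a by (R_0 + δ)⁻¹ R_w a, which is continuous
in z. The error is TΔ^w a with T = δ(R_0 + δ)⁻¹, so it is at most max(‖Ta‖, ‖Tb‖). Choose δ to make
this small at z₀; since T is a contraction and a, b are continuous, it stays small nearby. -/
lemma continuousOn_stripOrbit_regPow {A : H →L[ℂ] H} (hA : A ∈ realOperators V) (x : H) :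
    ContinuousOn (fun z => stripOrbit V A z (regPow (halfSum V) 0 x)) closedStrip := by
  have hC := isPosResolvent_halfSum V
  refine continuousOn_of_locally_uniform_approx_of_continuousWithinAt fun z₀ hz₀ u hu => ?_
  obtain ⟨ε, hε, hεu⟩ := Metric.mem_uniformity_dist.1 hu
  set a := fun z => lowerVec V A x (stripExp z) with ha
  set b := fun z => upperVec V A x (stripExp z) with hb
  have ha1 := (hC.tendsto_smul_regOp (a z₀)).eventually (Metric.ball_mem_nhds _ (show 0 < ε / 4 by
    positivity))
  have hb1 := (hC.tendsto_smul_regOp (b z₀)).eventually (Metric.ball_mem_nhds _ (show 0 < ε / 4 by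
    positivity))
  obtain ⟨δ, ⟨ha2, hb2⟩, hδ⟩ := ((ha1.and hb1).and self_mem_nhdsWithin).exists
  rw [dist_zero_right] at ha2 hb2
  have hδ0 : 0 < δ := hδ
  have hn := hC.norm_smul_regOp_le hδ0
  set T := (δ : ℂ) • regOp (halfSum V) δ with hT
  have hT1 : 1 - regPow (halfSum V) 0 * regOp (halfSum V) δ = T := hC.one_sub_regOp hδ0
  have hTc : ∀ w, Commute T (regPow (halfSum V) w) := fun w =>
    (IsPosResolvent.regOp_commute δ w).smul_left _
  have ha3 := Metric.tendsto_nhds.1 (continuousOn_lowerVec (V := V) A x z₀ hz₀) (ε / 4)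
    (by positivity)
  have hb3 := Metric.tendsto_nhds.1 (continuousOn_upperVec (V := V) A x z₀ hz₀) (ε / 4)
    (by positivity)
  refine ⟨_, (ha3.and hb3).and self_mem_nhdsWithin, fun z => regOp (halfSum V) δ
    (regPow (halfSum V) (stripExp z) (a z)), ?_, ?_⟩
  · have h1 : ContinuousOn (fun z => regPow (halfSum V) (stripExp z)) closedStrip :=
      hC.differentiableOn_regPow.continuousOn.comp differentiable_stripExp.continuous.continuousOn
        fun z hz => abs_stripExp hz
    exact ((regOp (halfSum V) δ).continuous.comp_continuousOn
      (h1.clm_apply (continuousOn_lowerVec A x))) z₀ hz₀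
  · rintro z ⟨⟨ha4, hb4⟩, hz⟩
    refine hεu ?_
    rw [dist_eq_norm] at ha4 hb4 ⊢
    have e1 : stripOrbit V A z (regPow (halfSum V) 0 x) -
        regOp (halfSum V) δ (regPow (halfSum V) (stripExp z) (a z)) =
        T (stripOrbit V A z (regPow (halfSum V) 0 x)) := by
      rw [← hT1, ha, ← regPow_stripOrbit hA x hz, ← (IsPosResolvent.regOp_commute δ 0).eq]
      rfl
    have e2 : ∀ v v₀ : H, ‖T v₀‖ < ε / 4 → ‖v - v₀‖ < ε / 4 → ‖T v‖ ≤ ε / 2 := by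
      intro v v₀ h1 h2
      have h3 : ‖T (v - v₀)‖ ≤ ‖v - v₀‖ :=
        (le_opNorm _ _).trans (mul_le_of_le_one_left (norm_nonneg _) hn)
      have h4 : T v = T v₀ + T (v - v₀) := by rw [map_sub]; abel
      rw [h4]
      linarith [norm_add_le (T v₀) (T (v - v₀))]
    have hcomm : ∀ w v, T (regPow (halfSum V) w v) = regPow (halfSum V) w (T v) := fun w v =>
      DFunLike.congr_fun (hTc w).eq v
    rw [e1]
    refine (hC.norm_le_of_regPow_eq (a := T (a z)) (b := T (b z)) (K := ε / 2) (stripExp_mem hz)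
      ?_ ?_ (e2 _ _ ha2 ha4) (e2 _ _ hb2 hb4)).trans_lt (by linarith)
    · rw [← hcomm, ← hcomm, hb, regPow_upperVec hA x (stripExp_mem hz)]
    · rw [← hcomm, ← hcomm, regPow_stripOrbit hA x hz]

lemma continuousOn_stripOrbit {A : H →L[ℂ] H} (hA : A ∈ realOperators V) (x : H) :
    ContinuousOn (fun z => stripOrbit V A z x) closedStrip := by
  have hC := isPosResolvent_halfSum V
  refine continuousOn_of_uniform_approx_of_continuousOn fun u hu => ?_
  obtain ⟨ε, hε, hεu⟩ := Metric.mem_uniformity_dist.1 hu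
  obtain ⟨y, hy⟩ := (hC.regPow_denseRange (w := 0) (by simp)).exists_dist_lt x
    (show 0 < ε / (‖A‖ + 1) by positivity)
  refine ⟨_, continuousOn_stripOrbit_regPow hA y, fun z hz => hεu ?_⟩
  rw [dist_eq_norm] at hy ⊢
  rw [← map_sub]
  calc _ ≤ ‖stripOrbit V A z‖ * ‖x - regPow (halfSum V) 0 y‖ := le_opNorm _ _
    _ ≤ (‖A‖ + 1) * ‖x - regPow (halfSum V) 0 y‖ := by
        gcongr
        linarith [(stripOrbit_spec hA hz).1]
    _ < (‖A‖ + 1) * (ε / (‖A‖ + 1)) := by gcongr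
    _ = ε := by field_simp

lemma isContinuation_stripOrbit {A : H →L[ℂ] H} (hA : A ∈ realOperators V) :
    IsContinuation V A (stripOrbit V A) :=
  ⟨stripOrbit_real hA, continuousOn_stripOrbit hA, differentiableOn_stripOrbit hA⟩

lemma IsContinuation.eqOn {A : H →L[ℂ] H} {F G : ℂ → H →L[ℂ] H} (hF : IsContinuation V A F)
    (hG : IsContinuation V A G) : EqOn F G closedStrip := by
  intro z hz
  ext x
  refine ext_inner_left ℂ fun y => ?_
  rw [← sub_eq_zero, ← inner_sub_right]
  refine eqOn_zero_closedStrip (f := fun z => ⟪y, F z x - G z x⟫) ?_ ?_ ?_ hz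
  · exact (innerSL ℂ y).continuous.comp_continuousOn
      ((hF.continuousOn x).sub (hG.continuousOn x))
  · exact (innerSL ℂ y).differentiable.comp_differentiableOn
      ((hF.differentiableOn.clm_apply (differentiableOn_const x)).sub
        (hG.differentiableOn.clm_apply (differentiableOn_const x)))
  · intro t
    rw [hF.real, hG.real, sub_self, inner_zero_right]

lemma isContinuation_orbit {A : H →L[ℂ] H} (hA : A ∈ realOperators V) :
    IsContinuation V A (orbit V A) := by
  have h : ∃ F, IsContinuation V A F := ⟨_, isContinuation_stripOrbit hA⟩
  rw [orbit, dif_pos h]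
  exact h.choose_spec

lemma orbit_eq {A : H →L[ℂ] H} (hA : A ∈ realOperators V) {z : ℂ} (hz : z ∈ closedStrip) :
    orbit V A z = stripOrbit V A z :=
  (isContinuation_orbit hA).eqOn (isContinuation_stripOrbit hA) hz

lemma norm_orbit_le {A : H →L[ℂ] H} (hA : A ∈ realOperators V) {z : ℂ} (hz : z ∈ closedStrip) :
    ‖orbit V A z‖ ≤ ‖A‖ := by
  rw [orbit_eq hA hz]; exact (stripOrbit_spec hA hz).1

lemma regPow_mul_orbit_mul {A : H →L[ℂ] H} (hA : A ∈ realOperators V) {z : ℂ}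
    (hz : z ∈ closedStrip) : regPow (halfSum V) 0 * orbit V A z * regPow (halfSum V) 0 =
      regOrbit V A (stripExp z) := by
  rw [orbit_eq hA hz]; exact (stripOrbit_spec hA hz).2

end StdSub

end

/-! ### Algebraic and topological properties of α_z. -/

noncomputable section

namespace StdSub

open Filter Topology Set Metric ContinuousLinearMap

variable {H : Type*} [NormedAddCommGroup H] [InnerProductSpace ℂ H] [CompleteSpace H]
  {V : StandardSubspace H}

/-! ### The involution -/

lemma conjBy_add (A B : H →L[ℂ] H) : conjBy V (A + B) = conjBy V A + conjBy V B := by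
  ext x; simp

lemma conjBy_mul (A B : H →L[ℂ] H) : conjBy V (A * B) = conjBy V A * conjBy V B := by
  ext x; simp [polarConj_polarConj]

lemma conjBy_smul (c : ℂ) (A : H →L[ℂ] H) : conjBy V (c • A) = star c • conjBy V A := by
  ext x; simp

lemma conjBy_conjBy (A : H →L[ℂ] H) : conjBy V (conjBy V A) = A := by
  ext x; simp [polarConj_polarConj]

lemma norm_conjBy (A : H →L[ℂ] H) : ‖conjBy V A‖ = ‖A‖ := by
  have key : ∀ A : H →L[ℂ] H, ‖conjBy V A‖ ≤ ‖A‖ := fun A =>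
    opNorm_le_bound _ (norm_nonneg _) (norm_conjBy_apply_le A)
  refine le_antisymm (key A) ?_
  conv_lhs => rw [← conjBy_conjBy (V := V) A]
  exact key _

lemma star_conjBy (A : H →L[ℂ] H) : star (conjBy V A) = conjBy V (star A) := by
  refine ((eq_adjoint_iff _ _).2 fun x y => ?_).symm
  rw [conjBy_apply, conjBy_apply, inner_polarConj V x, ← inner_conj_symm,
    inner_polarConj V y, inner_conj_symm, star_eq_adjoint, adjoint_inner_right]

lemma sharp_eq (A : H →L[ℂ] H) : sharp V A = conjBy V (star A) := by
  rw [sharp, modularConj_eq]; rfl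

lemma conjBy_regPow {w : ℂ} (hw : |w.re| < 1) :
    conjBy V (regPow (halfSum V) w) = regPow (halfSum V) (-star w) := by
  ext x
  rw [conjBy_apply, polarConj_regPow V hw, polarConj_polarConj]

lemma conjBy_regPow_zero : conjBy V (regPow (halfSum V) 0) = regPow (halfSum V) 0 := by
  rw [conjBy_regPow (by simp)]; simp

lemma isAlgInvolution_sharp : IsAlgInvolution (sharp V) where
  map_add a b := by simp only [sharp_eq, star_add, conjBy_add]
  map_smul r a := by
    simp only [sharp_eq, ← Complex.coe_smul r, star_smul, conjBy_smul, star_star]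
  map_mul a b := by simp only [sharp_eq, star_mul, conjBy_mul]
  map_map a := by simp only [sharp_eq, star_conjBy, star_star, conjBy_conjBy]
  norm_map a := by rw [sharp_eq, norm_conjBy, norm_star]

omit [CompleteSpace H] in
lemma isClosed_realOperators : IsClosed (realOperators V : Set (H →L[ℂ] H)) := by
  have : (realOperators V : Set (H →L[ℂ] H)) =
      ⋂ v ∈ V.toClosedSubmodule, {A : H →L[ℂ] H | A v ∈ V.toClosedSubmodule} := by
    ext A
    simp only [mem_iInter]
    rfl
  rw [this]
  refine isClosed_biInter fun v _ => ?_
  exact V.toClosedSubmodule.isClosed.preimage (by fun_prop : Continuous fun A : H →L[ℂ] H => A v)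

/-- `J` maps `V` onto its symplectic complement. -/
lemma polarConj_mem_iff (x : H) : polarConj V x ∈ V.toClosedSubmodule ↔
    ∀ v ∈ V.toClosedSubmodule, ⟪v, x⟫.im = 0 := by
  -- With P and P' the projections onto V and iV, one has PJ = J(1 - P'), so Jx lies in V exactly
  -- when P'x = 0.
  have h1 : polarConj V x ∈ V.toClosedSubmodule ↔ realProj V (I • x) = 0 := by
    have h2 : halfDiff V (polarConj V x) = polarConj V (halfDiff V x) := by
      rw [← polarConj_sqrtOp, ← sqrtOp_polarConj]
    have h3 : realProj V (polarConj V x) = polarConj V x -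
        polarConj V (halfSum V x - halfDiff V x) := by
      rw [← halfSum_add_halfDiff, h2, map_sub, polarConj_halfSum]
      abel
    rw [← realProj_eq_self_iff, h3, halfSum_sub_halfDiff, sub_eq_self, ← norm_eq_zero,
      norm_polarConj, norm_eq_zero, neg_eq_zero, smul_eq_zero, or_iff_right I_ne_zero]
  have h4 : ∀ v, ⟪v, I • x⟫.re = -⟪v, x⟫.im := fun v => by simp
  rw [h1]
  constructor
  · intro h v hv
    rw [← neg_eq_zero, ← h4, ← (realProj_eq_self_iff V).2 hv, ← re_inner_realProj, h,
      inner_zero_right, zero_re]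
  · intro h
    have h5 := h _ (realProj_mem V (I • x))
    rw [← neg_eq_zero, ← h4, ← realProj_realProj, ← re_inner_realProj, inner_self_eq_ofReal,
      ofReal_re] at h5
    exact norm_eq_zero.1 (pow_eq_zero_iff two_ne_zero |>.1 h5)

/-- A* preserves the symplectic complement of V because Im⟪u, A*x⟫ = Im⟪Au, x⟫, and J exchanges that
complement with V. -/
lemma sharp_mem {A : H →L[ℂ] H} (hA : A ∈ realOperators V) : sharp V A ∈ realOperators V := by
  intro v hv
  rw [sharp_eq, conjBy_apply, polarConj_mem_iff]
  intro u hu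
  rw [star_eq_adjoint, adjoint_inner_right]
  rw [← polarConj_polarConj V v, polarConj_mem_iff] at hv
  exact hv _ (hA u hu)

/-! ### Algebraic properties of the continuation -/

lemma orbit_eq_of_regPow {A X : H →L[ℂ] H} (hA : A ∈ realOperators V) {z : ℂ}
    (hz : z ∈ closedStrip)
    (h : regPow (halfSum V) 0 * X * regPow (halfSum V) 0 = regOrbit V A (stripExp z)) :
    orbit V A z = X :=
  regPow_zero_mul_mul_injective (V := V) ((regPow_mul_orbit_mul hA hz).trans h.symm)

lemma orbit_one {z : ℂ} (hz : z ∈ closedStrip) : orbit V 1 z = 1 := by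
  refine orbit_eq_of_regPow (one_mem _) hz ?_
  have h := abs_stripExp hz
  rw [regOrbit, mul_one, mul_one]
  exact (isPosResolvent_halfSum V).regPow_mul_regPow (by simp) (by simp) h (by simpa using h)
    (by ring)

lemma orbit_add {A B : H →L[ℂ] H} (hA : A ∈ realOperators V) (hB : B ∈ realOperators V) {z : ℂ}
    (hz : z ∈ closedStrip) : orbit V (A + B) z = orbit V A z + orbit V B z := by
  refine orbit_eq_of_regPow (add_mem hA hB) hz ?_
  rw [mul_add, add_mul, regPow_mul_orbit_mul hA hz, regPow_mul_orbit_mul hB hz]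
  simp only [regOrbit, mul_add, add_mul]

lemma orbit_smul (r : ℝ) {A : H →L[ℂ] H} (hA : A ∈ realOperators V) {z : ℂ}
    (hz : z ∈ closedStrip) : orbit V (r • A) z = r • orbit V A z := by
  refine orbit_eq_of_regPow (Subalgebra.smul_mem _ hA r) hz ?_
  rw [mul_smul_comm, smul_mul_assoc, regPow_mul_orbit_mul hA hz, regOrbit, regOrbit,
    mul_smul_comm, smul_mul_assoc]

lemma orbit_sub {A B : H →L[ℂ] H} (hA : A ∈ realOperators V) (hB : B ∈ realOperators V) {z : ℂ}
    (hz : z ∈ closedStrip) : orbit V (A - B) z = orbit V A z - orbit V B z := by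
  have := orbit_add (sub_mem hA hB) hB hz
  rw [sub_add_cancel] at this
  rw [this, add_sub_cancel_right]

lemma modularUnitary_mul_neg (s : ℝ) : modularUnitary V s * modularUnitary V (-s) = 1 := by
  refine regPow_zero_mul_mul_injective (V := V) ?_
  rw [← mul_assoc, regPow_zero_mul_modularUnitary, mul_assoc, modularUnitary_mul_regPow_zero,
    mul_one]
  exact (isPosResolvent_halfSum V).regPow_mul_regPow (by simp) (by simp) (by simp) (by simp)
    (by push_cast; ring)

omit [CompleteSpace H] in
lemma continuousOn_apply_apply {F G : ℂ → H →L[ℂ] H} {s : Set ℂ} {K : ℝ}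
    (hF : ∀ x, ContinuousOn (fun z => F z x) s) (hK : ∀ z ∈ s, ‖F z‖ ≤ K) {x : H}
    (hG : ContinuousOn (fun z => G z x) s) : ContinuousOn (fun z => F z (G z x)) s := by
  intro c hc
  have h1 : Tendsto (fun z => F z (G z x - G c x)) (𝓝[s] c) (𝓝 0) := by
    have h2 : Tendsto (fun z => K * ‖G z x - G c x‖) (𝓝[s] c) (𝓝 (K * ‖G c x - G c x‖)) :=
      (((hG c hc).tendsto.sub_const _).norm).const_mul K
    rw [sub_self, norm_zero, mul_zero] at h2
    refine squeeze_zero_norm' ?_ h2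
    filter_upwards [self_mem_nhdsWithin] with z hz
    exact (le_opNorm _ _).trans (mul_le_mul_of_nonneg_right (hK z hz) (norm_nonneg _))
  have h3 := h1.add (hF (G c x) c hc).tendsto
  simp only [map_sub, sub_add_cancel, zero_add] at h3
  exact h3

/-- By uniqueness: on the real line the inner modular unitaries cancel, and the bound on ‖α^A(z)‖
makes the product strongly continuous. -/
lemma orbit_mul {A B : H →L[ℂ] H} (hA : A ∈ realOperators V) (hB : B ∈ realOperators V) {z : ℂ}
    (hz : z ∈ closedStrip) : orbit V (A * B) z = orbit V A z * orbit V B z := by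
  have hA' := isContinuation_orbit hA
  have hB' := isContinuation_orbit hB
  refine (isContinuation_orbit (mul_mem hA hB)).eqOn (G := fun z => orbit V A z * orbit V B z)
    ⟨fun t => ?_, fun x => ?_, ?_⟩ hz
  · rw [hA'.real, hB'.real]
    have h := modularUnitary_mul_neg (V := V) (t / (2 * Real.pi))
    rw [← neg_div] at h
    simp only [mul_assoc]
    rw [← mul_assoc (modularUnitary V (t / (2 * Real.pi))), h, one_mul]
  · exact continuousOn_apply_apply hA'.continuousOn (fun z hz => norm_orbit_le hA hz)
      (hB'.continuousOn x)
  · exact hA'.differentiableOn.mul hB'.differentiableOn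

lemma conjBy_regOrbit (A : H →L[ℂ] H) {w : ℂ} (hw : |w.re| < 1) :
    conjBy V (regOrbit V A w) = regOrbit V (conjBy V A) (-star w) := by
  rw [regOrbit, conjBy_mul, conjBy_mul, conjBy_regPow hw, conjBy_regPow (by simpa using hw),
    regOrbit]
  simp

lemma star_regOrbit (A : H →L[ℂ] H) (w : ℂ) :
    star (regOrbit V A w) = regOrbit V (star A) (-star w) := by
  have hC := isPosResolvent_halfSum V
  rw [regOrbit, star_mul, star_mul, hC.star_regPow, hC.star_regPow, regOrbit, mul_assoc]
  simp

lemma star_regPow_zero : star (regPow (halfSum V) 0) = regPow (halfSum V) 0 := by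
  rw [(isPosResolvent_halfSum V).star_regPow, star_zero]

/-- Taking adjoints and conjugating by J both send the exponent w to -w̄, so together they leave it
fixed. -/
lemma orbit_sharp {A : H →L[ℂ] H} (hA : A ∈ realOperators V) {z : ℂ} (hz : z ∈ closedStrip) :
    orbit V (sharp V A) z = sharp V (orbit V A z) := by
  refine orbit_eq_of_regPow (sharp_mem hA) hz ?_
  have h := congrArg (fun T => conjBy V (star T)) (regPow_mul_orbit_mul hA hz)
  simp only [star_mul, star_regPow_zero, conjBy_mul, conjBy_regPow_zero] at h
  rw [star_regOrbit, conjBy_regOrbit _ (by simpa using abs_stripExp hz)] at h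
  rw [sharp_eq, sharp_eq, mul_assoc, h]
  simp

/-- R_w A R_{-w} determines A, since R_w is injective and R_{-w} has dense range. -/
lemma orbit_injective {A B : H →L[ℂ] H} (hA : A ∈ realOperators V) (hB : B ∈ realOperators V)
    {z : ℂ} (hz : z ∈ closedStrip) (h : orbit V A z = orbit V B z) : A = B := by
  have hC := isPosResolvent_halfSum V
  have hw := abs_stripExp hz
  have h1 := regPow_mul_orbit_mul hA hz
  rw [h, regPow_mul_orbit_mul hB hz] at h1
  exact (eq_of_comp_injective (hC.regPow_injective hw) (eq_of_comp_denseRange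
    (hC.regPow_denseRange (by simpa using hw)) h1)).symm

/-- The morphism `α_z`. -/
def orbitHom (V : StandardSubspace H) {z : ℂ} (hz : z ∈ closedStrip) :
    realOperators V →ₐ[ℝ] (H →L[ℂ] H) :=
  AlgHom.ofLinearMap
    { toFun := fun A => orbit V A z
      map_add' := fun A B => orbit_add A.2 B.2 hz
      map_smul' := fun r A => orbit_smul r A.2 hz }
    (orbit_one hz) (fun A B => orbit_mul A.2 B.2 hz)

/-! ### Continuity for the strong operator topology -/

/-- By the vector three lines estimate for B - A, its image at R_0 y is controlled by the values of
B - A at only two vectors, `a` and J`b`. The remainder x - R_0 y is handled by ‖B - A‖ ≤ 2, which is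
where the unit ball enters. -/
lemma continuousOn_toSOT_orbit {z : ℂ} (hz : z ∈ closedStrip) :
    ContinuousOn (fun T : H →Lₚₜ[ℂ] H => toSOT (orbit V (toSOT.symm T) z))
      (toSOT '' {A : H →L[ℂ] H | A ∈ realOperators V ∧ ‖A‖ ≤ 1}) := by
  have hC := isPosResolvent_halfSum V
  rintro _ ⟨A, ⟨hA, hA1⟩, rfl⟩
  refine PointwiseConvergenceCLM.tendsto_iff_forall_tendsto.2 fun x => ?_
  have heval : ∀ y : H, Tendsto (fun T : H →Lₚₜ[ℂ] H => (toSOT.symm T) y)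
      (𝓝[toSOT '' {A : H →L[ℂ] H | A ∈ realOperators V ∧ ‖A‖ ≤ 1}] (toSOT A)) (𝓝 (A y)) :=
    fun y => (PointwiseConvergenceCLM.tendsto_iff_forall_tendsto.1
      (tendsto_id.mono_left nhdsWithin_le_nhds)) y
  rw [Metric.tendsto_nhds]
  intro ε hε
  obtain ⟨y, hy⟩ := (hC.regPow_denseRange (w := 0) (by simp)).exists_dist_lt x
    (show 0 < ε / 4 by positivity)
  set a := regPow (halfSum V) (-stripExp z) y with ha
  set b := regPow (halfSum V) (1 / 2 - stripExp z) y with hb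
  have h1 := Metric.tendsto_nhds.1 (heval a) (ε / 4) (by positivity)
  have h2 := Metric.tendsto_nhds.1 (heval (polarConj V b)) (ε / 4) (by positivity)
  filter_upwards [h1, h2, self_mem_nhdsWithin] with T h3 h4 hT
  obtain ⟨B, ⟨hB, hB1⟩, rfl⟩ := hT
  rw [LinearEquiv.symm_apply_apply] at h3 h4
  rw [dist_eq_norm] at hy h3 h4
  have hBA := sub_mem hB hA
  change dist (orbit V (toSOT.symm (toSOT B)) z x) (orbit V (toSOT.symm (toSOT A)) z x) < ε
  rw [LinearEquiv.symm_apply_apply, LinearEquiv.symm_apply_apply, dist_eq_norm]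
  have e1 : orbit V B z x - orbit V A z x =
      orbit V (B - A) z (x - regPow (halfSum V) 0 y) +
        stripOrbit V (B - A) z (regPow (halfSum V) 0 y) := by
    rw [← orbit_eq hBA hz, ← map_add, sub_add_cancel, orbit_sub hB hA hz]
    rfl
  have e2 : ‖stripOrbit V (B - A) z (regPow (halfSum V) 0 y)‖ ≤ ε / 4 := by
    refine norm_stripOrbit_apply_le hBA y hz ?_ ?_
    · exact h3.le
    · rw [upperVec, conjBy_apply, norm_polarConj]
      exact h4.le
  have e3 : ‖orbit V (B - A) z (x - regPow (halfSum V) 0 y)‖ ≤ 2 * (ε / 4) := by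
    refine (le_opNorm _ _).trans ?_
    have h5 : ‖orbit V (B - A) z‖ ≤ 2 :=
      (norm_orbit_le hBA hz).trans ((norm_sub_le _ _).trans (by linarith))
    gcongr
  rw [e1]
  exact (norm_add_le _ _).trans_lt (by linarith)

/-! ### The midpoint of the strip -/

lemma mid_mem : (Real.pi * I / 2 : ℂ) ∈ closedStrip := by
  have : (Real.pi * I / 2 : ℂ).im = Real.pi / 2 := by simp
  constructor <;> rw [this] <;> linarith [Real.pi_pos]

lemma stripExp_mid : stripExp (Real.pi * I / 2) = 1 / 4 := by
  have : (Real.pi : ℂ) ≠ 0 := ofReal_ne_zero.2 Real.pi_ne_zero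
  rw [stripExp]
  field_simp
  rw [I_sq]
  norm_num

/-- J turns Δ^{1/4} A Δ^{-1/4} into Δ^{-1/4} (JAJ) Δ^{1/4}. Inserting JAJ = Δ^{1/2} A Δ^{-1/2}
returns the original operator. -/
lemma conjBy_orbit_mid {A : H →L[ℂ] H} (hA : A ∈ realOperators V) :
    conjBy V (orbit V A (Real.pi * I / 2)) = orbit V A (Real.pi * I / 2) := by
  have hC := isPosResolvent_halfSum V
  symm
  refine orbit_eq_of_regPow hA mid_mem ?_
  have h := congrArg (conjBy V) (regPow_mul_orbit_mul hA mid_mem)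
  rw [conjBy_mul, conjBy_mul, conjBy_regPow_zero, stripExp_mid,
    conjBy_regOrbit _ (by norm_num)] at h
  rw [h, stripExp_mid]
  have hstar : -star (1 / 4 : ℂ) = -(1 / 4) := by simp
  rw [hstar]
  have key := regOrbit_half hA
  have h1 : regPow (halfSum V) (-(1 / 4)) * regPow (halfSum V) (1 / 2) =
      regPow (halfSum V) 0 * regPow (halfSum V) (1 / 4) :=
    hC.regPow_mul_regPow (by norm_num) (by norm_num) (by norm_num) (by norm_num) (by ring)
  have h2 : regPow (halfSum V) (-(1 / 2)) * regPow (halfSum V) (1 / 4) =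
      regPow (halfSum V) (-(1 / 4)) * regPow (halfSum V) 0 :=
    hC.regPow_mul_regPow (by norm_num) (by norm_num) (by norm_num) (by norm_num) (by ring)
  refine regPow_zero_mul_mul_injective (V := V) ?_
  calc regPow (halfSum V) 0 * regOrbit V (conjBy V A) (-(1 / 4)) * regPow (halfSum V) 0
      = (regPow (halfSum V) 0 * regPow (halfSum V) (-(1 / 4))) * conjBy V A *
        (regPow (halfSum V) (1 / 4) * regPow (halfSum V) 0) := by
        simp only [regOrbit, mul_assoc, neg_neg]
    _ = regPow (halfSum V) (-(1 / 4)) * (regPow (halfSum V) 0 * conjBy V A *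
        regPow (halfSum V) 0) * regPow (halfSum V) (1 / 4) := by
        rw [(IsPosResolvent.regPow_commute 0 (-(1 / 4))).eq,
          (IsPosResolvent.regPow_commute (1 / 4) 0).eq]
        simp only [mul_assoc]
    _ = (regPow (halfSum V) (-(1 / 4)) * regPow (halfSum V) (1 / 2)) * A *
        (regPow (halfSum V) (-(1 / 2)) * regPow (halfSum V) (1 / 4)) := by
        rw [← key]; simp only [regOrbit, mul_assoc]
    _ = _ := by rw [h1, h2]; simp only [regOrbit, mul_assoc]

/-- X commutes with J at the midpoint, so X^♯ = JX*J = (JXJ)* = X*. -/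
lemma adjoint_orbit_mid {A : H →L[ℂ] H} (hA : A ∈ realOperators V) :
    adjoint (orbit V A (Real.pi * I / 2)) = orbit V (sharp V A) (Real.pi * I / 2) := by
  rw [orbit_sharp hA mid_mem, sharp_eq, ← star_conjBy, conjBy_orbit_mid hA, star_eq_adjoint]

lemma orbit_mid_modularConj {A : H →L[ℂ] H} (hA : A ∈ realOperators V) (x : H) :
    orbit V A (Real.pi * I / 2) (modularConj V x) =
      modularConj V (orbit V A (Real.pi * I / 2) x) := by
  rw [modularConj_eq]
  conv_lhs => rw [← conjBy_orbit_mid hA]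
  rw [conjBy_apply, polarConj_polarConj]

lemma orbit_mid_mem {A : H →L[ℂ] H} (hA : A ∈ realOperators V) {x : H}
    (hx : x ∈ fixedSubspace V) : orbit V A (Real.pi * I / 2) x ∈ fixedSubspace V := by
  change modularConj V _ = _
  rw [← orbit_mid_modularConj hA, show modularConj V x = x from hx]

/-- The operator on `H^{J_V}` induced by `α_{πi/2}(A)`. -/
def fixedRepr (A : realOperators V) : fixedSubspace V →L[ℝ] fixedSubspace V :=
  (((orbit V A (Real.pi * I / 2)).restrictScalars ℝ).comp (fixedSubspace V).subtypeL).codRestrict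
    (fixedSubspace V) fun x => orbit_mid_mem A.2 x.2

@[simp] lemma coe_fixedRepr (A : realOperators V) (x : fixedSubspace V) :
    (fixedRepr A x : H) = orbit V A (Real.pi * I / 2) (x : H) := rfl

/-- The representation of `𝒜_V` on `H^{J_V}` given by `α_{πi/2}`. -/
def fixedHom (V : StandardSubspace H) :
    realOperators V →ₐ[ℝ] (fixedSubspace V →L[ℝ] fixedSubspace V) :=
  AlgHom.ofLinearMap
    { toFun := fixedRepr
      map_add' := fun A B => by
        ext x
        simp [orbit_add A.2 B.2 mid_mem]
      map_smul' := fun r A => by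
        ext x
        simp [orbit_smul r A.2 mid_mem] }
    (by
      ext x
      simp [orbit_one mid_mem])
    (fun A B => by
      ext x
      simp [orbit_mul A.2 B.2 mid_mem])

end StdSub

end

open StdSub in
theorem proposition2p6 {H : Type*} [NormedAddCommGroup H] [InnerProductSpace ℂ H] [CompleteSpace H]
    (V : StandardSubspace H) :
    -- `♯` is an isometric involution of `B(H)`, and `𝒜_V` is a closed real subalgebra
    IsAlgInvolution (sharp V) ∧
    IsClosed (realOperators V : Set (H →L[ℂ] H)) ∧
    -- for `A ∈ 𝒜_V` the continuation `α^A` exists and is unique on the closed strip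
    (∀ A ∈ realOperators V, IsContinuation V A (orbit V A) ∧
      ∀ F, IsContinuation V A F → Set.EqOn F (orbit V A) closedStrip) ∧
    -- `𝒜_V` is invariant under `♯`
    ∃ hs : ∀ A ∈ realOperators V, sharp V A ∈ realOperators V,
      (∀ z ∈ closedStrip,
        -- `α_z` is an injective contractive morphism of real unital involutive Banach algebras
        (∃ φ : realOperators V →ₐ[ℝ] (H →L[ℂ] H),
          (∀ A : realOperators V, φ A = orbit V A z) ∧
          (∀ A : realOperators V, φ ⟨sharp V A, hs A A.2⟩ = sharp V (φ A)) ∧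
          Function.Injective φ ∧
          (∀ A : realOperators V, ‖φ A‖ ≤ ‖A‖)) ∧
        -- `α_z` is strongly continuous on the closed unit ball of `𝒜_V`
        ContinuousOn (fun T : H →Lₚₜ[ℂ] H => toSOT (orbit V (toSOT.symm T) z))
          (toSOT '' {A : H →L[ℂ] H | A ∈ realOperators V ∧ ‖A‖ ≤ 1})) ∧
      (∀ A ∈ realOperators V,
        ContinuousLinearMap.adjoint (orbit V A (Real.pi * Complex.I / 2)) =
          orbit V (sharp V A) (Real.pi * Complex.I / 2) ∧
        ∀ ξ, orbit V A (Real.pi * Complex.I / 2) (modularConj V ξ) =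
          modularConj V (orbit V A (Real.pi * Complex.I / 2) ξ)) ∧
      -- the resulting `*`-representation on the real Hilbert space `H^{J_V}`
      ∃ ρ : realOperators V →ₐ[ℝ] (fixedSubspace V →L[ℝ] fixedSubspace V),
        (∀ (A : realOperators V) (ξ : fixedSubspace V),
          (ρ A ξ : H) = orbit V A (Real.pi * Complex.I / 2) (ξ : H)) ∧
        ∀ A : realOperators V, ρ ⟨sharp V A, hs A A.2⟩ = ContinuousLinearMap.adjoint (ρ A) := by
  refine ⟨isAlgInvolution_sharp, isClosed_realOperators, fun A hA => ⟨isContinuation_orbit hA,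
    fun F hF => hF.eqOn (isContinuation_orbit hA)⟩, fun A hA => sharp_mem hA, fun z hz => ⟨?_,
    continuousOn_toSOT_orbit hz⟩, fun A hA => ⟨adjoint_orbit_mid hA, orbit_mid_modularConj hA⟩,
    fixedHom V, fun A ξ => rfl, fun A => ?_⟩
  · refine ⟨orbitHom V hz, fun A => rfl, fun A => orbit_sharp A.2 hz, fun A B h => ?_,
      fun A => norm_orbit_le A.2 hz⟩
    exact Subtype.ext (orbit_injective A.2 B.2 hz h)
  · refine (ContinuousLinearMap.eq_adjoint_iff _ _).2 fun x y => ?_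
    have h := ContinuousLinearMap.adjoint_inner_left (orbit V A (Real.pi * Complex.I / 2))
      (y : H) (x : H)
    rw [adjoint_orbit_mid A.2] at h
    -- The inner product of H^{J_V} is the real part of that of H.
    exact congrArg Complex.re h
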